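/- Let $d\ge 3$, $\delta>0$, $R>0$, and let $0<\gamma=\tau<\frac23$ and $2\tau<\kappa<2-\tau$ (in particular $\kappa+\tau<2$). Let the cross-section $b(z,\sigma)\ge 0$, depending only on $|z|$ and $\frac{z}{|z|}\cdot\sigma$, satisfy $b\in L^1\cap L^\infty(\mathbb{R}^d\times\mathbb{S}^{d-1})\cap C(B(0,2R)\times\mathbb{S}^{d-1})$ and $b>0$ on $B(0,2R)\times\mathbb{S}^{d-1}$. Write $$Q_{\mathrm{FD}}(f)(v)=\int_{\mathbb{R}^d\times\mathbb{S}^{d-1}}\Big(f'f'_*(1-\delta f)(1-\delta f_*)-ff_*(1-\delta f')(1-\delta f'_*)\Big)\,b(v-v_*,\sigma)\,dv_*d\sigma,$$ where $f_*,f',f'_*$ are the values of $f$ at $v_*$, $v'=\frac{v+v_*}2+\frac{|v-v_*|}2\sigma$, $v'_*=\frac{v+v_*}2-\frac{|v-v_*|}2\sigma$, and $$M_\varepsilon(v)=\frac1\delta\Big(1+\exp\Big(\frac{|v|^2-R^2}{\varepsilon^\tau}\Big)\Big)^{-1},\qquad H(f|M_\varepsilon)=\int_{\mathbb{R}^d\times\mathbb{R}^d}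 h(\delta f,\delta M_\varepsilon)\,dxdv,$$ $$h(z,a)=z\log\frac za+(1-z)\log\frac{1-z}{1-a},$$ $$D(f)=\frac1{4\delta}\int_{(\mathbb{R}^d)^3\times\mathbb{S}^{d-1}}(Y-Z)\log\Big(\frac YZ\Big)\,b(v-v_*,\sigma)\,dxdvdv_*d\sigma,$$ $$Y=\delta f'\,\delta f'_*(1-\delta f)(1-\delta f_*),\qquad Z=\delta f\,\delta f_*(1-\delta f')(1-\delta f'_*),$$ with the usual conventions: $0\log 0=0$, and $(Y-Z)\log(Y/Z)$ equals $0$ if $Y=Z$ and $+\infty$ if exactly one of $Y,Z$ vanishes. Let $\Lambda\subset(0,\infty)$ be a set of parameters having $0$ as an accumulation point (for instance $(0,1)$, or the values of a sequence tending to $0$). For each $\varepsilon\in\Lambda$, let $f_\varepsilon^{\mathrm{in}}(x,v)$ be measurable with $0\le f_\varepsilon^{\mathrm{in}}\le\delta^{-1}$, and let $f_\varepsilon(t,x,v)$ be measurable on $[0,\infty)\times\mathbb{R}^d\times\mathbb{R}^d$, with $0\le f_\varepsilon\le\delta^{-1}$, and be a weak solution (in the sense of distributions, with smooth test functions compactly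 supported in $[0,\infty)\times\mathbb{R}^d\times\mathbb{R}^d$) of $$(\partial_t+v\cdot\nabla_x)f_\varepsilon=\frac1{\varepsilon^\kappa}Q_{\mathrm{FD}}(f_\varepsilon),\qquad f_\varepsilon|_{t=0}=f_\varepsilon^{\mathrm{in}},$$ satisfying, for almost every $t>0$, the entropy inequality $$H(f_\varepsilon|M_\varepsilon)(t)+\frac1{\varepsilon^\kappa}\int_0^tD(f_\varepsilon)(s)\,ds\le H(f_\varepsilon^{\mathrm{in}}|M_\varepsilon).$$ Assume that $\varepsilon^{-(2-\gamma)}H(f_\varepsilon^{\mathrm{in}}|M_\varepsilon)\le C^{\mathrm{in}}$ for all $\varepsilon\in\Lambda$, with a constant $C^{\mathrm{in}}>0$ independent of $\varepsilon$. For $\alpha>0$, set $\chi(v)=\mathbf 1_{\{|v^2-R^2|/\varepsilon^{\tau}<-\log\varepsilon^\alpha\}}$ and consider the conservation defects $$D_\varepsilon(t,x)=\frac1{\varepsilon^{\kappa+1}}\int_{\mathbb{R}^d}\frac{v^2-R^2}{\varepsilon^\tau}\,Q_{\mathrm{FD}}(f_\varepsilon)(t,x,v)\,\chi(v)\,dv.$$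 Then there is $\alpha_0>0$, depending only on $d,\delta,R,\tau,\kappa$, such that, for every $\alpha\ge\alpha_0$, the defects $D_\varepsilon$ are well defined (their integrals converge absolutely), belong to $L^1_{\mathrm{loc}}([0,\infty)\times\mathbb{R}^d)$, and converge to zero strongly in $L^1_{\mathrm{loc}}(dtdx)$, i.e., $\int_K|D_\varepsilon|\,dtdx\to0$ as $\varepsilon\to0$ in $\Lambda$, for every compact set $K\subset[0,\infty)\times\mathbb{R}^d$. -/

import Mathlib

open MeasureTheory Set Filter Topology
open scoped ENNReal ContDiff

noncomputable section

namespace FermiGas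

/-- The Euclidean space `ℝ^d`. -/
abbrev E (d : ℕ) : Type := EuclideanSpace ℝ (Fin d)

/-- The unit sphere of `ℝ^d`. -/
abbrev S (d : ℕ) : Type := Metric.sphere (0 : E d) 1

/-- The surface measure `dσ` on the unit sphere. -/
def surface (d : ℕ) : Measure (S d) := (volume : Measure (E d)).toSphere

variable {d : ℕ}

/-- Post-collisional velocity `v' = (v + v_*)/2 + |v - v_*| σ / 2`. -/
def post (v vs : E d) (σ : S d) : E d :=
  (1 / 2 : ℝ) • (v + vs) + (‖v - vs‖ / 2) • (σ : E d)

/-- Post-collisional velocity `v_*' = (v + v_*)/2 - |v - v_*| σ / 2`. -/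
def postStar (v vs : E d) (σ : S d) : E d :=
  (1 / 2 : ℝ) • (v + vs) - (‖v - vs‖ / 2) • (σ : E d)

/-- The gain product `F' F_*' (1 - δ F) (1 - δ F_*)`, for a velocity density `F`. -/
def gain (δ : ℝ) (F : E d → ℝ) (v vs : E d) (σ : S d) : ℝ :=
  F (post v vs σ) * F (postStar v vs σ) * (1 - δ * F v) * (1 - δ * F vs)

/-- The loss product `F F_* (1 - δ F') (1 - δ F_*')`, for a velocity density `F`. -/
def loss (δ : ℝ) (F : E d → ℝ) (v vs : E d) (σ : S d) : ℝ :=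
  F v * F vs * (1 - δ * F (post v vs σ)) * (1 - δ * F (postStar v vs σ))

/-- The integrand of the Boltzmann--Fermi--Dirac collision operator, in `(v_*, σ)`. -/
def collisionIntegrand (δ : ℝ) (b : E d → S d → ℝ) (F : E d → ℝ) (v : E d) (p : E d × S d) : ℝ :=
  (gain δ F v p.1 p.2 - loss δ F v p.1 p.2) * b (v - p.1) p.2

/-- The Boltzmann--Fermi--Dirac collision operator `Q_FD(F)(v)`. -/
def collision (δ : ℝ) (b : E d → S d → ℝ) (F : E d → ℝ) (v : E d) : ℝ :=
  ∫ p : E d × S d, collisionIntegrand δ b F v p ∂((volume : Measure (E d)).prod (surface d))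

/-- The rescaled energy variable `u = (|v|² - R²) / ε^τ`. -/
def energy (R τ ε : ℝ) (v : E d) : ℝ := (‖v‖ ^ 2 - R ^ 2) / ε ^ τ

/-- The normalized low-temperature Fermi--Dirac distribution
`M_ε(v) = δ⁻¹ (1 + exp((|v|² - R²)/ε^τ))⁻¹`. -/
def fermiDirac (δ R τ ε : ℝ) (v : E d) : ℝ := δ⁻¹ * (1 + Real.exp (energy R τ ε v))⁻¹

/-- `h(z, a) = z log (z/a) + (1 - z) log ((1 - z)/(1 - a))`, for `z ∈ [0,1]`, `a ∈ (0,1)`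
(with `0 log 0 = 0`). It is nonnegative there. -/
def entropyFun (z a : ℝ) : ℝ :=
  z * Real.log (z / a) + (1 - z) * Real.log ((1 - z) / (1 - a))

/-- The relative entropy `H(F | M) = ∫∫ h(δ F, δ M) dx dv`, with values in `[0, ∞]`. -/
def relEntropy (δ : ℝ) (F : E d → E d → ℝ) (M : E d → ℝ) : ℝ≥0∞ :=
  ∫⁻ x : E d, ∫⁻ v : E d, ENNReal.ofReal (entropyFun (δ * F x v) (δ * M v))

/-- `(y - z) log (y/z) ∈ [0, ∞]` for `y, z ≥ 0`, with the usual conventions: the value is `0`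
if `y = z`, and `∞` if exactly one of `y`, `z` vanishes. -/
def dissipationFun (y z : ℝ) : ℝ≥0∞ :=
  if y = z then 0
  else if y = 0 ∨ z = 0 then ⊤
  else ENNReal.ofReal ((y - z) * Real.log (y / z))

/-- The entropy dissipation `D(F)`, with values in `[0, ∞]`. The products
`δF' δF_*' (1 - δF)(1 - δF_*)` and `δF δF_* (1 - δF')(1 - δF_*')` are `δ²` times
`gain` and `loss`. -/
def entropyDissipation (δ : ℝ) (b : E d → S d → ℝ) (F : E d → E d → ℝ) : ℝ≥0∞ :=
  ENNReal.ofReal (1 / (4 * δ)) *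
    ∫⁻ x : E d, ∫⁻ v : E d, ∫⁻ vs : E d, ∫⁻ σ : S d,
      dissipationFun (δ ^ 2 * gain δ (F x) v vs σ) (δ ^ 2 * loss δ (F x) v vs σ) *
        ENNReal.ofReal (b (v - vs) σ) ∂(surface d)

/-- Admissible cross-sections: `b(z, σ) ≥ 0` depends only on `|z|` and on `(z/|z|)·σ`, belongs to
`L¹ ∩ L^∞(ℝ^d × 𝕊^{d-1}) ∩ C(B(0,2R) × 𝕊^{d-1})`, and is positive on `B(0,2R) × 𝕊^{d-1}`. -/
structure IsCrossSection (R : ℝ) (b : E d → S d → ℝ) : Prop where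
  measurable : Measurable (Function.uncurry b)
  nonneg : ∀ z σ, 0 ≤ b z σ
  isotropic : ∃ β : ℝ → ℝ → ℝ, ∀ z : E d, z ≠ 0 → ∀ σ : S d,
    b z σ = β ‖z‖ (inner ℝ (‖z‖⁻¹ • z) (σ : E d))
  integrable : Integrable (Function.uncurry b) ((volume : Measure (E d)).prod (surface d))
  bounded : MemLp (Function.uncurry b) ⊤ ((volume : Measure (E d)).prod (surface d))
  continuousOn : ContinuousOn (Function.uncurry b) (Metric.ball (0 : E d) (2 * R) ×ˢ univ)
  pos : ∀ z ∈ Metric.ball (0 : E d) (2 * R), ∀ σ, 0 < b z σ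

/-- `f` is a weak solution on `t ≥ 0` of
`(∂_t + v·∇_x) f = ε^{-κ} Q_FD(f)`, `f|_{t=0} = fin`: testing against any smooth compactly supported
`φ(t,x,v)`. Here `fderiv ℝ φ (t,x,v) (1,v,0) = (∂_t + v·∇_x) φ(t,x,v)`. -/
def IsWeakSolution (δ κ ε : ℝ) (b : E d → S d → ℝ) (fin : E d → E d → ℝ)
    (f : ℝ → E d → E d → ℝ) : Prop :=
  ∀ φ : ℝ × E d × E d → ℝ, ContDiff ℝ ∞ φ → HasCompactSupport φ →
    (∫ p : E d × E d, fin p.1 p.2 * φ (0, p.1, p.2))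
      + (∫ p in Ioi (0 : ℝ) ×ˢ (univ : Set (E d × E d)),
          f p.1 p.2.1 p.2.2 * fderiv ℝ φ p (1, p.2.2, 0))
      + (1 / ε ^ κ) * (∫ p in Ioi (0 : ℝ) ×ˢ (univ : Set (E d × E d)),
          collision δ b (f p.1 p.2.1) p.2.2 * φ p) = 0

/-- `f` is a solution in `L^∞`, with `0 ≤ f ≤ δ⁻¹`, of the scaled Boltzmann--Fermi--Dirac equation
with initial datum `fin`, `0 ≤ fin ≤ δ⁻¹`, which satisfies the scaled entropy inequality
`H(f|M_ε)(t) + ε^{-κ} ∫_0^t D(f)(s) ds ≤ H(fin|M_ε)` for (almost) all `t > 0`. Densities are given by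
measurable representatives satisfying the pointwise bounds; only the times `t ≥ 0` matter. -/
structure IsEntropicSolution (δ R τ κ ε : ℝ) (b : E d → S d → ℝ) (fin : E d → E d → ℝ)
    (f : ℝ → E d → E d → ℝ) : Prop where
  measurable_fin : Measurable fun p : E d × E d => fin p.1 p.2
  fin_mem : ∀ x v, fin x v ∈ Icc 0 δ⁻¹
  measurable : Measurable fun p : ℝ × E d × E d => f p.1 p.2.1 p.2.2
  mem : ∀ t, 0 ≤ t → ∀ x v, f t x v ∈ Icc 0 δ⁻¹
  weak : IsWeakSolution δ κ ε b fin f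
  entropy : ∀ᵐ t ∂(volume.restrict (Ioi (0 : ℝ))),
    relEntropy δ (f t) (fermiDirac δ R τ ε)
        + ENNReal.ofReal (1 / ε ^ κ) * ∫⁻ s in Ioc 0 t, entropyDissipation δ b (f s)
      ≤ relEntropy δ fin (fermiDirac δ R τ ε)

/-- The cutoff `χ(v)`, the indicator function of `{|v² - R²|/ε^τ < - log ε^α}`. -/
def cutoff (R τ α ε : ℝ) : E d → ℝ :=
  {v : E d | |‖v‖ ^ 2 - R ^ 2| / ε ^ τ < - Real.log (ε ^ α)}.indicator 1

/-- The integrand, in `v`, of the conservation defect. -/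
def defectIntegrand (δ R τ α ε : ℝ) (b : E d → S d → ℝ) (F : E d → ℝ) (v : E d) : ℝ :=
  energy R τ ε v * collision δ b F v * cutoff R τ α ε v

/-- The conservation defect
`D_ε(t,x) = ε^{-κ-1} ∫ ((v² - R²)/ε^τ) Q_FD(f)(t,x,v) χ(v) dv`. -/
def defect (δ R τ κ α ε : ℝ) (b : E d → S d → ℝ) (f : ℝ → E d → E d → ℝ) (p : ℝ × E d) : ℝ :=
  (1 / ε ^ (κ + 1)) * ∫ v : E d, defectIntegrand δ R τ α ε b (f p.1 p.2) v

end FermiGas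

end

noncomputable section

namespace FermiGas

variable {d : ℕ}

/-! Write `u` for the rescaled energy and `L = -log ε^α = α |log ε|` for the truncation level. Since
collisions conserve energy, testing the collision operator against `u` would give zero; only the
truncation `|u| < L` creates a defect. Symmetrizing over the collision group
(`integral_mul_collision`) replaces the test function by its balance over the four velocities of a
collision. This balance is at most `4L`. It vanishes unless one of the four velocities has `|u| ≥ L`
while the energy of its partner is confined to an interval of length `O(L)`
(`exists_energy_confined`). On such collisions, with `Y`, `Z` the rescaled gain and loss, one has
for every `θ > 0` that `|Y - Z| ≤ θ min(Y, Z) + (1 + θ⁻¹)(Y - Z) log(Y/Z)`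
(`abs_sub_le_min_add_dissipationFun`). The last term is the density of the entropy dissipation,
whose time integral is `O(ε^(κ+2-τ))` by the entropy inequality. In the other term, `min(Y, Z)` is
at most the vacancy `min(δF, 1 - δF)` at the velocity outside the truncation (`min_gain_loss_le`).
Far from the Fermi sphere such a vacancy is expensive: the relative entropy bounds `L` times the
integrated vacancy by `O(ε^(2-τ))`, the Gaussian tails being negligible once `α` is large
(`mul_outerVacancy_le`). The confined partner ranges over spherical shells of volume `O(ε^τ L)`
(`volume_confined_le`), and `b` is bounded, so this term is `θ O(ε^2)`: the two factors `L` cancel.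
Altogether the defect on a bounded set is `O(L ε^(-κ-1) (θ ε^2 + θ⁻¹ ε^(κ+2-τ)))`. The choice `θ =
ε^((κ-τ)/2)` balances the terms and leaves `O(|log ε| ε^(1-(κ+τ)/2))`, which tends to zero because
`κ + τ < 2`. -/

/-! ### Scalar inequalities -/

/-- Fenchel-type lower bound for the relative entropy density against the Fermi function. -/
theorem mul_le_entropyFun_add {z a u : ℝ} (hz : z ∈ Icc (0 : ℝ) 1)
    (ha : a = (1 + Real.exp u)⁻¹) :
    z * (u / 2) ≤ entropyFun z a + Real.exp (-(u / 2)) := by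
  have hE := Real.exp_pos u
  have ha0 : 0 < a := by rw [ha]; positivity
  have ha1 : 1 - a = Real.exp u * a := by rw [ha]; field_simp; ring
  have h1a : 0 < 1 - a := by rw [ha1]; positivity
  have key : ∀ x y : ℝ, 0 ≤ x → 0 < y → x - y ≤ x * Real.log (x / y) := by
    intro x y hx hy
    rcases hx.eq_or_lt with rfl | hx
    · simp [hy.le]
    · have := Real.one_sub_inv_le_log_of_pos (div_pos hx hy)
      calc x - y = x * (1 - (x / y)⁻¹) := by field_simp
        _ ≤ _ := by gcongr
  -- Tilting the reference value from `a` to `a e^(u/2)` produces the linear term `z u/2`. As `a ≤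
  -- e^(-u)`, the tilted value is still at most `e^(-u/2)`, which is the remainder.
  have h1 := key z (a * Real.exp (u / 2)) hz.1 (by positivity)
  have h2 := key (1 - z) (1 - a) (by linarith [hz.2]) h1a
  have h3 : z * Real.log (z / (a * Real.exp (u / 2))) = z * Real.log (z / a) - z * (u / 2) := by
    rcases hz.1.eq_or_lt with rfl | hx
    · simp
    · rw [← div_div, Real.log_div (by positivity) (by positivity), Real.log_exp]; ring
  have h4 : a * Real.exp (u / 2) ≤ Real.exp (-(u / 2)) := by
    have : a ≤ Real.exp (-u) := by
      rw [ha, Real.exp_neg]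
      gcongr
      linarith
    calc a * Real.exp (u / 2) ≤ Real.exp (-u) * Real.exp (u / 2) := by gcongr
      _ = _ := by rw [← Real.exp_add]; ring_nf
  unfold entropyFun
  linarith

theorem entropyFun_one_sub (z a : ℝ) : entropyFun (1 - z) (1 - a) = entropyFun z a := by
  simp [entropyFun, add_comm]

/-- Particle-hole symmetry: exchanging `z` with `1 - z` changes the sign of `u`, so negative
energies reduce to positive ones. Particles are expensive above the Fermi level and holes below it;
the minimum covers both. -/
theorem min_mul_abs_le_entropyFun_add {z u : ℝ} (hz : z ∈ Icc (0 : ℝ) 1) :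
    min z (1 - z) * (|u| / 2) ≤ entropyFun z (1 + Real.exp u)⁻¹ + Real.exp (-(|u| / 2)) := by
  rcases le_total 0 u with hu | hu
  · rw [abs_of_nonneg hu]
    refine le_trans ?_ (mul_le_entropyFun_add hz rfl)
    gcongr
    exact min_le_left _ _
  · rw [abs_of_nonpos hu]
    have h : (1 - (1 + Real.exp u)⁻¹) = (1 + Real.exp (-u))⁻¹ := by
      have := Real.exp_pos u
      rw [Real.exp_neg]; field_simp; ring
    rw [← entropyFun_one_sub]
    have hz' : 1 - z ∈ Icc (0 : ℝ) 1 := ⟨by linarith [hz.2], by linarith [hz.1]⟩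
    refine le_trans ?_ (mul_le_entropyFun_add hz' h)
    gcongr
    · linarith
    · exact min_le_right _ _

/-- Either `|y - z|` is at most `θ min(y, z)`, or `max(y, z) ≤ (1 + θ⁻¹)|y - z|`. In the second case
`log t ≥ 1 - 1/t` gives `(y - z) log(y/z) ≥ (y - z)²/max(y, z)`, which dominates `|y - z|` up to the
factor `1 + θ⁻¹`. The parameter `θ` is left free so as to be optimized in `ε`. -/
theorem abs_sub_le_min_add_dissipationFun {y z θ : ℝ} (hy : 0 ≤ y) (hz : 0 ≤ z) (hθ : 0 < θ) :
    ENNReal.ofReal |y - z| ≤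
      ENNReal.ofReal θ * ENNReal.ofReal (min y z)
        + ENNReal.ofReal (1 + θ⁻¹) * dissipationFun y z := by
  have main : ∀ y z : ℝ, 0 < z → z < y →
      y - z ≤ θ * z + (1 + θ⁻¹) * ((y - z) * Real.log (y / z)) := by
    intro y z hz hzy
    have hy : 0 < y := hz.trans hzy
    have hk : 0 < y - z := by linarith
    have hlog := Real.one_sub_inv_le_log_of_pos (div_pos hy hz)
    have h1 : (y - z) * ((y - z) / y) ≤ (y - z) * Real.log (y / z) := by
      gcongr
      calc (y - z) / y = 1 - (y / z)⁻¹ := by field_simp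
        _ ≤ _ := hlog
    have h0 : 0 ≤ (y - z) * ((y - z) / y) := by positivity
    by_cases hc : y - z ≤ θ * z
    · have : 0 ≤ (1 + θ⁻¹) * ((y - z) * Real.log (y / z)) := by
        have := h0.trans h1
        positivity
      linarith
    · push Not at hc
      have h2 : y ≤ (1 + θ⁻¹) * (y - z) := by
        have : z ≤ θ⁻¹ * (y - z) := by
          rw [inv_mul_eq_div, le_div_iff₀ hθ]; linarith
        linarith
      have h3 : y - z ≤ (1 + θ⁻¹) * ((y - z) * ((y - z) / y)) := by
        have : (1 + θ⁻¹) * ((y - z) * ((y - z) / y))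
          = (y - z) * (((1 + θ⁻¹) * (y - z)) / y) := by ring
        rw [this]
        have : 1 ≤ ((1 + θ⁻¹) * (y - z)) / y := by rwa [one_le_div hy]
        nlinarith
      have h4 : (1 + θ⁻¹) * ((y - z) * ((y - z) / y))
          ≤ (1 + θ⁻¹) * ((y - z) * Real.log (y / z)) := by gcongr
      have : 0 ≤ θ * z := by positivity
      linarith
  have hpos : 0 < 1 + θ⁻¹ := by positivity
  unfold dissipationFun
  split_ifs with h1 h2
  · simp [h1]
  · rw [ENNReal.mul_top (by simpa using hpos)]
    simp
  · push Not at h2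
    have hy' : 0 < y := lt_of_le_of_ne hy (Ne.symm h2.1)
    have hz' : 0 < z := lt_of_le_of_ne hz (Ne.symm h2.2)
    rw [← ENNReal.ofReal_mul hθ.le, ← ENNReal.ofReal_mul hpos.le]
    refine le_trans (ENNReal.ofReal_le_ofReal ?_) ENNReal.ofReal_add_le
    rcases lt_or_gt_of_ne h1 with h | h
    · rw [min_eq_left h.le, abs_sub_comm, abs_of_pos (by linarith)]
      have := main z y hy' h
      have e : (y - z) * Real.log (y / z) = (z - y) * Real.log (z / y) := by
        rw [← inv_div z y, Real.log_inv]; ring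
      rw [e]; exact this
    · rw [min_eq_right h.le, abs_of_pos (by linarith)]
      exact main y z hz' h

/-- If the energy balance of a collision is broken by the truncation `|u| < L`, then one of the
four energies is at least `L` in modulus while its partner is confined to an interval. -/
theorem exists_energy_confined {L a b c e : ℝ} (hsum : a + b = c + e)
    (hw : (if |a| < L then a else 0) + (if |b| < L then b else 0)
      - (if |c| < L then c else 0) - (if |e| < L then e else 0) ≠ 0) :
    (L ≤ |a| ∧ (|b| < L ∨ |a + b| < 2 * L)) ∨ (L ≤ |b| ∧ (|a| < L ∨ |b + a| < 2 * L)) ∨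
    (L ≤ |c| ∧ (|e| < L ∨ |c + e| < 2 * L)) ∨ (L ≤ |e| ∧ (|c| < L ∨ |e + c| < 2 * L)) := by
  have key : ∀ x y : ℝ, |x| < L → |y| < L → |x + y| < 2 * L := fun x y hx hy => by
    linarith [abs_add_le x y]
  -- If all four energies are inside, or all outside, the balance is zero. If a pair is split, its
  -- inner member is the confined partner. Otherwise one pair is inside and the other outside, and
  -- the common sum, bounded by `2L`, confines the outer pair.
  by_cases ha : |a| < L <;> by_cases hb : |b| < L <;> by_cases hc : |c| < L <;>
    by_cases he : |e| < L <;> simp only [ha, hb, hc, he, if_true, if_false] at hw <;>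
    first
    | exact absurd (by linarith) hw
    | (have := key a b ha hb; rw [hsum] at this; grind)
    | (have := key c e hc he; rw [← hsum] at this; grind)
    | grind

/-! ### Geometry of collisions -/

theorem norm_sphere (σ : S d) : ‖(σ : E d)‖ = 1 := by simp

theorem post_sub_postStar (v vs : E d) (σ : S d) :
    post v vs σ - postStar v vs σ = ‖v - vs‖ • (σ : E d) := by
  unfold post postStar
  module

theorem post_add_postStar (v vs : E d) (σ : S d) :
    post v vs σ + postStar v vs σ = v + vs := by
  unfold post postStar
  module

theorem norm_sq_post_add (v vs : E d) (σ : S d) :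
    ‖post v vs σ‖ ^ 2 + ‖postStar v vs σ‖ ^ 2 = ‖v‖ ^ 2 + ‖vs‖ ^ 2 := by
  have h1 := parallelogram_law_with_norm ℝ (post v vs σ) (postStar v vs σ)
  have h2 := parallelogram_law_with_norm ℝ v vs
  rw [post_sub_postStar, post_add_postStar, norm_smul, norm_sphere, norm_norm] at h1
  nlinarith

theorem energy_post_add (R τ ε : ℝ) (v vs : E d) (σ : S d) :
    energy R τ ε (post v vs σ) + energy R τ ε (postStar v vs σ)
      = energy R τ ε v + energy R τ ε vs := by
  unfold energy
  rw [← add_div, ← add_div]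
  congr 1
  linarith [norm_sq_post_add v vs σ]

theorem post_swap_neg (v vs : E d) (σ : S d) : post vs v (-σ) = postStar v vs σ := by
  unfold post postStar
  rw [norm_sub_rev, add_comm vs v]
  simp [sub_eq_add_neg]

theorem postStar_swap_neg (v vs : E d) (σ : S d) : postStar vs v (-σ) = post v vs σ := by
  unfold post postStar
  rw [norm_sub_rev, add_comm vs v]
  simp [sub_eq_add_neg]

/-- The direction of a vector, with value `e` at the origin. -/
def direction (e : S d) (z : E d) : S d :=
  if h : z = 0 then e else ⟨‖z‖⁻¹ • z, by simp [norm_smul, h]⟩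

theorem coe_direction (e : S d) {z : E d} (hz : z ≠ 0) :
    (direction e z : E d) = ‖z‖⁻¹ • z := by
  simp [direction, hz]

theorem norm_smul_direction (e : S d) (z : E d) : ‖z‖ • (direction e z : E d) = z := by
  by_cases hz : z = 0
  · simp [hz]
  · rw [coe_direction e hz, smul_smul, mul_inv_cancel₀ (by simpa using hz), one_smul]

theorem direction_smul (e σ : S d) {r : ℝ} (hr : 0 < r) : direction e (r • (σ : E d)) = σ := by
  have h0 : r • (σ : E d) ≠ 0 := by
    rw [← norm_ne_zero_iff, norm_smul, norm_sphere]; simp [hr.ne']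
  apply Subtype.ext
  rw [coe_direction e h0, norm_smul, norm_sphere, smul_smul]
  simp [abs_of_pos hr, hr.ne']

theorem measurable_direction (e : S d) : Measurable (direction e) := by
  refine Measurable.subtype_mk (f := fun z => (direction e z : E d)) ?_ (h := fun z => (direction e z).2)
  have : (fun z => (direction e z : E d)) = fun z => if z = 0 then (e : E d) else ‖z‖⁻¹ • z := by
    ext1 z
    split_ifs with h
    · simp [direction, h]
    · exact coe_direction e h
  rw [this]
  exact Measurable.ite (measurableSet_singleton _) measurable_const (by fun_prop)

/-- The relative velocity after the collision is `|v - v_*| σ`; colliding again along the direction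
of `v - v_*` restores the original one. The arbitrary value `e` at the origin is harmless, being
multiplied by zero. -/
theorem post_collide (e : S d) (v vs : E d) (σ : S d) :
    post (post v vs σ) (postStar v vs σ) (direction e (v - vs)) = v := by
  have h : post (post v vs σ) (postStar v vs σ) (direction e (v - vs))
      = (1 / 2 : ℝ) • (v + vs) + (1 / 2 : ℝ) • (‖v - vs‖ • (direction e (v - vs) : E d)) := by
    conv_lhs => rw [post, post_add_postStar, post_sub_postStar, norm_smul, norm_sphere, norm_norm]
    module
  rw [h, norm_smul_direction]
  module

theorem postStar_collide (e : S d) (v vs : E d) (σ : S d) :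
    postStar (post v vs σ) (postStar v vs σ) (direction e (v - vs)) = vs := by
  have h := post_add_postStar (post v vs σ) (postStar v vs σ) (direction e (v - vs))
  rw [post_collide, post_add_postStar] at h
  exact add_left_cancel h

/-! ### Measure of spherical shells -/

/-- The bound is linear in `h` and uniform in `A`, even when the shell degenerates to a ball: with
radii `r₁ ≤ r₂`, `r₂^d - r₁^d ≤ d r₂^(d-2) · r₂(r₂ - r₁)` and `r₂(r₂ - r₁) ≤ r₂² - r₁² ≤ 2h`.
Splitting off one factor `r₂` is where `d ≥ 2` enters. -/
theorem volume_shell_le (hd : 2 ≤ d) {A h P : ℝ} (hP : 0 ≤ P) (hA : A + h ≤ P ^ 2) :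
    volume {v : E d | |‖v‖ ^ 2 - A| < h}
      ≤ ENNReal.ofReal (2 * d * P ^ (d - 2) * h) * volume (Metric.ball (0 : E d) 1) := by
  have : Nonempty (Fin d) := ⟨⟨0, by omega⟩⟩
  have : Nontrivial (E d) := inferInstance
  rcases le_or_gt (A + h) 0 with hneg | hpos
  · have : {v : E d | |‖v‖ ^ 2 - A| < h} = ∅ := by
      ext v
      simp only [mem_ofPred_eq, mem_empty_iff_false, iff_false, not_lt]
      exact le_trans (by nlinarith [sq_nonneg ‖v‖]) (le_abs_self _)
    rw [this]; simp
  by_cases hh : h ≤ 0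
  · have : {v : E d | |‖v‖ ^ 2 - A| < h} = ∅ := by
      ext v
      simp only [mem_ofPred_eq, mem_empty_iff_false, iff_false, not_lt]
      exact hh.trans (abs_nonneg _)
    rw [this]; simp
  push Not at hh
  set r₂ := √(A + h) with hr₂
  set r₁ := √(A - h) with hr₁
  have h20 : 0 ≤ r₂ := Real.sqrt_nonneg _
  have h10 : 0 ≤ r₁ := Real.sqrt_nonneg _
  have h12 : r₁ ≤ r₂ := Real.sqrt_le_sqrt (by linarith)
  have hsub : {v : E d | |‖v‖ ^ 2 - A| < h} ⊆ Metric.ball 0 r₂ \ Metric.ball 0 r₁ := by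
    intro v hv
    rw [mem_ofPred_eq, abs_lt] at hv
    refine ⟨?_, ?_⟩
    · rw [mem_ball_zero_iff, hr₂]
      exact Real.lt_sqrt_of_sq_lt (by linarith)
    · rw [mem_ball_zero_iff, not_lt, hr₁]
      exact Real.sqrt_le_iff.2 ⟨norm_nonneg _, by linarith⟩
  have h2P : r₂ ≤ P := Real.sqrt_le_iff.2 ⟨hP, hA⟩
  have hpow : r₂ ^ d - r₁ ^ d ≤ 2 * d * P ^ (d - 2) * h := by
    have h1 := abs_pow_sub_pow_le r₂ r₁ d
    rw [abs_of_nonneg h20, abs_of_nonneg h10, max_eq_left h12,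
      abs_of_nonneg (show 0 ≤ r₂ - r₁ by linarith)] at h1
    have h2 : r₂ * (r₂ - r₁) ≤ 2 * h := by
      have e2 : r₂ ^ 2 = A + h := Real.sq_sqrt hpos.le
      have e1 : A - h ≤ r₁ ^ 2 := by
        rcases le_total 0 (A - h) with h0 | h0
        · exact (Real.sq_sqrt h0).ge
        · exact h0.trans (sq_nonneg _)
      nlinarith
    have h3 : r₂ ^ (d - 1) = r₂ ^ (d - 2) * r₂ := by
      rw [← pow_succ]; congr 1; omega
    calc r₂ ^ d - r₁ ^ d ≤ (r₂ - r₁) * d * r₂ ^ (d - 1) :=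
          (le_abs_self _).trans h1
      _ = d * r₂ ^ (d - 2) * (r₂ * (r₂ - r₁)) := by rw [h3]; ring
      _ ≤ d * P ^ (d - 2) * (2 * h) := by gcongr
      _ = _ := by ring
  calc volume {v : E d | |‖v‖ ^ 2 - A| < h}
      ≤ volume (Metric.ball (0 : E d) r₂ \ Metric.ball 0 r₁) := measure_mono hsub
    _ = volume (Metric.ball (0 : E d) r₂) - volume (Metric.ball (0 : E d) r₁) :=
        measure_sdiff (Metric.ball_subset_ball h12) measurableSet_ball.nullMeasurableSet
          measure_ball_lt_top.ne
    _ = ENNReal.ofReal (r₂ ^ d - r₁ ^ d) * volume (Metric.ball (0 : E d) 1) := by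
        rw [Measure.addHaar_ball _ _ h20, Measure.addHaar_ball _ _ h10,
          ENNReal.ofReal_sub _ (by positivity), ENNReal.sub_mul fun _ _ => measure_ball_lt_top.ne]
        simp
    _ ≤ _ := by gcongr

instance : IsFiniteMeasure (surface d) := by
  unfold surface; infer_instance

instance : SFinite ((volume : Measure (E d)).prod (surface d)) :=
  Measure.prod.instSFinite

/-! ### Measure-preserving symmetries of the collision space -/

theorem measurePreserving_neg_surface :
    MeasurePreserving (fun σ : S d => -σ) (surface d) (surface d) := by
  refine ⟨measurable_neg, ?_⟩
  ext s hs
  rw [Measure.map_apply measurable_neg hs]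
  unfold surface
  rw [Measure.toSphere_apply' _ hs, Measure.toSphere_apply' _ (measurable_neg hs)]
  congr 1
  have : ((↑) '' ((fun σ : S d => -σ) ⁻¹' s) : Set (E d)) = -((↑) '' s) := by
    ext x
    simp only [mem_image, mem_preimage, Set.mem_neg]
    constructor
    · rintro ⟨y, hy, rfl⟩
      exact ⟨-y, hy, rfl⟩
    · rintro ⟨y, hy, h⟩
      exact ⟨-y, by simpa using hy, by simp [h]⟩
  rw [this, Set.smul_neg, Measure.measure_neg]

/-- Integration in polar coordinates. -/
theorem lintegral_polar [Nontrivial (E d)] {g : E d → ℝ≥0∞} (hg : Measurable g) :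
    ∫⁻ z, g z = ∫⁻ η, ∫⁻ r, g (r.1 • (η : E d))
      ∂(Measure.volumeIoiPow (Module.finrank ℝ (E d) - 1)) ∂(surface d) := by
  have hmp := (volume : Measure (E d)).measurePreserving_homeomorphUnitSphereProd
  have h1 : ∫⁻ z, g z = ∫⁻ z : ({0}ᶜ : Set (E d)), g z ∂(Measure.comap Subtype.val volume) := by
    rw [lintegral_subtype_comap (measurableSet_singleton _).compl, restrict_compl_singleton]
  have hgm : Measurable fun p : S d × Ioi (0 : ℝ) => g (p.2.1 • (p.1 : E d)) := by fun_prop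
  rw [h1]
  have h2 := hmp.lintegral_comp hgm
  rw [lintegral_prod _ hgm.aemeasurable] at h2
  rw [surface, ← h2]
  refine lintegral_congr fun z => ?_
  have hz : ‖(z : E d)‖ ≠ 0 := norm_ne_zero_iff.2 z.2
  simp [smul_smul, hz]

theorem measurable_exchange (e : S d) :
    Measurable fun p : E d × S d => ((‖p.1‖ • (p.2 : E d), direction e p.1) : E d × S d) :=
  Measurable.prodMk (by fun_prop) ((measurable_direction e).comp measurable_fst)

/-- Exchanging the directions of `z` and `σ` preserves `dz dσ`. -/
theorem lintegral_exchange (e : S d) [Nontrivial (E d)] {g : E d × S d → ℝ≥0∞}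
    (hg : Measurable g) :
    ∫⁻ z, ∫⁻ σ, g (‖z‖ • (σ : E d), direction e z) ∂(surface d)
      = ∫⁻ z, ∫⁻ σ, g (z, σ) ∂(surface d) := by
  have hg' : Measurable fun p : E d × S d => g (‖p.1‖ • (p.2 : E d), direction e p.1) :=
    hg.comp (measurable_exchange e)
  rw [lintegral_polar (Measurable.lintegral_prod_right' hg'),
    lintegral_polar (Measurable.lintegral_prod_right' hg)]
  -- In polar coordinates `z = rη` the exchange is `(r, η, σ) ↦ (r, σ, η)`, so the claim becomes
  -- Tonelli's theorem on two copies of the sphere.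
  have key : ∀ (η : S d) (r : Ioi (0 : ℝ)),
      ∫⁻ σ, g (‖r.1 • (η : E d)‖ • (σ : E d), direction e (r.1 • (η : E d)))
        ∂(surface d)
      = ∫⁻ σ, g (r.1 • (σ : E d), η) ∂(surface d) := by
    intro η r
    have hr : (0 : ℝ) < r.1 := r.2
    refine lintegral_congr fun σ => ?_
    rw [direction_smul e η hr, norm_smul, norm_sphere, mul_one, Real.norm_of_nonneg hr.le]
  simp_rw [key]
  have hm : Measurable fun q : (S d × S d) × Ioi (0 : ℝ) => g (q.2.1 • (q.1.2 : E d), q.1.1) := by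
    fun_prop
  have hm' : ∀ η : S d, Measurable fun q : Ioi (0 : ℝ) × S d => g (q.1.1 • (q.2 : E d), η) := by
    intro η; fun_prop
  have hm'' : ∀ η : S d, Measurable fun q : Ioi (0 : ℝ) × S d => g (q.1.1 • (η : E d), q.2) := by
    intro η; fun_prop
  calc _ = ∫⁻ η, ∫⁻ σ, ∫⁻ r, g (r.1 • (σ : E d), η)
        ∂(Measure.volumeIoiPow (Module.finrank ℝ (E d) - 1)) ∂(surface d) ∂(surface d) :=
        lintegral_congr fun η => lintegral_lintegral_swap (hm' η).aemeasurable
    _ = ∫⁻ σ, ∫⁻ η, ∫⁻ r, g (r.1 • (σ : E d), η)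
        ∂(Measure.volumeIoiPow (Module.finrank ℝ (E d) - 1)) ∂(surface d) ∂(surface d) :=
        lintegral_lintegral_swap (Measurable.lintegral_prod_right' hm).aemeasurable
    _ = _ := lintegral_congr fun σ => (lintegral_lintegral_swap (hm'' σ).aemeasurable).symm

/-- The measure `dv dv_* dσ`. -/
def collisionMeasure (d : ℕ) : Measure (E d × E d × S d) :=
  (volume : Measure (E d)).prod ((volume : Measure (E d)).prod (surface d))

instance : SFinite (collisionMeasure d) := by
  unfold collisionMeasure; infer_instance

/-- The pre-post collisional change of variables `(v, v_*, σ) ↦ (v', v_*', (v - v_*)/|v - v_*|)`. -/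
def collide (e : S d) (p : E d × E d × S d) : E d × E d × S d :=
  (post p.1 p.2.1 p.2.2, postStar p.1 p.2.1 p.2.2, direction e (p.1 - p.2.1))

/-- The exchange of particles `(v, v_*, σ) ↦ (v_*, v, -σ)`. -/
def swapParticles (p : E d × E d × S d) : E d × E d × S d := (p.2.1, p.1, -p.2.2)

theorem measurable_post : Measurable fun p : E d × E d × S d => post p.1 p.2.1 p.2.2 := by
  unfold post; fun_prop

theorem measurable_postStar : Measurable fun p : E d × E d × S d => postStar p.1 p.2.1 p.2.2 := by
  unfold postStar; fun_prop

theorem measurable_collide (e : S d) : Measurable (collide e) :=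
  measurable_post.prodMk (measurable_postStar.prodMk ((measurable_direction e).comp (by fun_prop)))

theorem lintegral_collisionMeasure {g : E d × E d × S d → ℝ≥0∞} (hg : Measurable g) :
    ∫⁻ p, g p ∂(collisionMeasure d) = ∫⁻ v, ∫⁻ vs, ∫⁻ σ, g (v, vs, σ) ∂(surface d) := by
  rw [collisionMeasure, lintegral_prod _ hg.aemeasurable]
  refine lintegral_congr fun v => ?_
  rw [lintegral_prod _ (by fun_prop)]

/-- Relative and centre-of-mass velocities as integration variables. -/
theorem lintegral_collisionMeasure_relative {g : E d × E d × S d → ℝ≥0∞} (hg : Measurable g) :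
    ∫⁻ p, g p ∂(collisionMeasure d) = ∫⁻ z, ∫⁻ σ, (∫⁻ c,
      g (c + (1 / 2 : ℝ) • z, c - (1 / 2 : ℝ) • z, σ)) ∂(surface d) := by
  have h1 : ∀ v : E d, ∫⁻ vs, ∫⁻ σ, g (v, vs, σ) ∂(surface d)
      = ∫⁻ z, ∫⁻ σ, g (v, v - z, σ) ∂(surface d) := fun v =>
    (lintegral_sub_left_eq_self (fun vs => ∫⁻ σ, g (v, vs, σ) ∂(surface d)) v).symm
  have hm1 : Measurable fun q : (E d × E d) × S d => g (q.1.1, q.1.1 - q.1.2, q.2) := by fun_prop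
  have hm2 : ∀ z : E d, Measurable fun q : E d × S d => g (q.1, q.1 - z, q.2) := by
    intro z; fun_prop
  rw [lintegral_collisionMeasure hg]
  simp_rw [h1]
  rw [lintegral_lintegral_swap (Measurable.lintegral_prod_right' hm1).aemeasurable]
  refine lintegral_congr fun z => ?_
  rw [lintegral_lintegral_swap (hm2 z).aemeasurable]
  refine lintegral_congr fun σ => ?_
  rw [← lintegral_add_right_eq_self (fun v => g (v, v - z, σ)) ((1 / 2 : ℝ) • z)]
  refine lintegral_congr fun c => ?_
  congr 3
  module

/-- In the variables `c = (v + v_*)/2`, `z = v - v_*`, a collision fixes `c` and exchanges the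
directions of `z` and `σ`. -/
theorem measurePreserving_collide (e : S d) [Nontrivial (E d)] :
    MeasurePreserving (collide e) (collisionMeasure d) (collisionMeasure d) := by
  refine ⟨measurable_collide e, Measure.ext_of_lintegral _ fun g hg => ?_⟩
  rw [lintegral_map hg (measurable_collide e),
    lintegral_collisionMeasure_relative (g := fun p => g (collide e p))
      (hg.comp (measurable_collide e)),
    lintegral_collisionMeasure_relative hg]
  have hm : Measurable fun q : (E d × S d) × E d =>
      g (q.2 + (1 / 2 : ℝ) • q.1.1, q.2 - (1 / 2 : ℝ) • q.1.1, q.1.2) := by fun_prop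
  rw [← lintegral_exchange e (Measurable.lintegral_prod_right' hm)]
  refine lintegral_congr fun z => lintegral_congr fun σ => lintegral_congr fun c => ?_
  have hz : c + (1 / 2 : ℝ) • z - (c - (1 / 2 : ℝ) • z) = z := by module
  simp only [collide, post, postStar, hz]
  congr 2
  · module
  · congr 1; module

theorem measurePreserving_swapParticles :
    MeasurePreserving (swapParticles (d := d)) (collisionMeasure d) (collisionMeasure d) := by
  have hm : Measurable (swapParticles (d := d)) := by unfold swapParticles; fun_prop
  refine ⟨hm, Measure.ext_of_lintegral _ fun g hg => ?_⟩
  rw [lintegral_map hg hm, lintegral_collisionMeasure (g := fun p => g (swapParticles p))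
      (hg.comp hm), lintegral_collisionMeasure hg]
  have hm' : Measurable fun q : (E d × E d) × S d => g (q.1.2, q.1.1, -q.2) := by fun_prop
  rw [lintegral_lintegral_swap]
  · refine lintegral_congr fun v => lintegral_congr fun vs => ?_
    exact measurePreserving_neg_surface.lintegral_comp (f := fun σ => g (v, vs, σ)) (by fun_prop)
  · exact (Measurable.lintegral_prod_right' hm').aemeasurable

/-! ### The collision integrand -/

/-- The isotropy of `b` is only meaningful for `z ≠ 0`, so the symmetries of the kernel hold off
this null set. -/
theorem ae_collisionMeasure_sub_ne_zero [Nontrivial (E d)] :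
    ∀ᵐ p ∂(collisionMeasure d), p.1 - p.2.1 ≠ 0 := by
  have hm : MeasurableSet {p : E d × E d × S d | p.1 - p.2.1 = 0} :=
    (measurable_fst.sub (measurable_fst.comp measurable_snd)) (measurableSet_singleton 0)
  rw [ae_iff]
  simp only [ne_eq, not_not]
  rw [collisionMeasure, Measure.measure_prod_null hm]
  refine Eventually.of_forall fun v => ?_
  have : Prod.mk v ⁻¹' {p : E d × E d × S d | p.1 - p.2.1 = 0} = {v} ×ˢ univ := by
    ext q
    simp [sub_eq_zero, eq_comm]
  simp only [this, Measure.prod_prod, Pi.zero_apply, measure_singleton, zero_mul]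

/-- The collision integrand as a function on the collision space. -/
def collisionKernel (δ : ℝ) (b : E d → S d → ℝ) (F : E d → ℝ) (p : E d × E d × S d) : ℝ :=
  collisionIntegrand δ b F p.1 p.2

theorem gain_swap (δ : ℝ) (F : E d → ℝ) (v vs : E d) (σ : S d) :
    gain δ F vs v (-σ) = gain δ F v vs σ := by
  simp only [gain, post_swap_neg, postStar_swap_neg]; ring

theorem loss_swap (δ : ℝ) (F : E d → ℝ) (v vs : E d) (σ : S d) :
    loss δ F vs v (-σ) = loss δ F v vs σ := by
  simp only [loss, post_swap_neg, postStar_swap_neg]; ring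

theorem gain_collide (e : S d) (δ : ℝ) (F : E d → ℝ) (v vs : E d) (σ : S d) :
    gain δ F (post v vs σ) (postStar v vs σ) (direction e (v - vs)) = loss δ F v vs σ := by
  simp only [gain, loss, post_collide, postStar_collide]

theorem loss_collide (e : S d) (δ : ℝ) (F : E d → ℝ) (v vs : E d) (σ : S d) :
    loss δ F (post v vs σ) (postStar v vs σ) (direction e (v - vs)) = gain δ F v vs σ := by
  simp only [gain, loss, post_collide, postStar_collide]

namespace IsCrossSection

variable {R : ℝ} {b : E d → S d → ℝ}

theorem swap (hb : IsCrossSection R b) {v vs : E d} (h : v - vs ≠ 0) (σ : S d) :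
    b (vs - v) (-σ) = b (v - vs) σ := by
  obtain ⟨β, hβ⟩ := hb.isotropic
  have h' : vs - v ≠ 0 := by rwa [← neg_sub, neg_ne_zero]
  rw [hβ _ h', hβ _ h, norm_sub_rev, ← neg_sub v vs, smul_neg]
  simp

/-- Microreversibility: exchanging `σ` with the direction of `v - v_*` changes neither the relative
speed nor the deflection angle. -/
theorem collide (hb : IsCrossSection R b) (e : S d) {v vs : E d} (h : v - vs ≠ 0) (σ : S d) :
    b (post v vs σ - postStar v vs σ) (direction e (v - vs)) = b (v - vs) σ := by
  obtain ⟨β, hβ⟩ := hb.isotropic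
  have hn : ‖v - vs‖ ≠ 0 := norm_ne_zero_iff.2 h
  have h' : ‖v - vs‖ • (σ : E d) ≠ 0 := by
    rw [← norm_ne_zero_iff, norm_smul, norm_sphere]; simpa using h
  rw [post_sub_postStar, hβ _ h', hβ _ h, norm_smul, norm_sphere, norm_norm, mul_one, smul_smul,
    inv_mul_cancel₀ hn, one_smul, coe_direction e h, real_inner_comm]

end IsCrossSection

section Kernel

variable {R δ : ℝ} {b : E d → S d → ℝ} {F : E d → ℝ}

theorem collisionKernel_swap (hb : IsCrossSection R b) (δ : ℝ) (F : E d → ℝ)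
    {p : E d × E d × S d} (hp : p.1 - p.2.1 ≠ 0) :
    collisionKernel δ b F (swapParticles p) = collisionKernel δ b F p := by
  simp only [collisionKernel, collisionIntegrand, swapParticles, gain_swap, loss_swap, hb.swap hp]

theorem collisionKernel_collide (hb : IsCrossSection R b) (e : S d) (δ : ℝ) (F : E d → ℝ)
    {p : E d × E d × S d} (hp : p.1 - p.2.1 ≠ 0) :
    collisionKernel δ b F (collide e p) = -collisionKernel δ b F p := by
  simp only [collisionKernel, collisionIntegrand, collide, gain_collide, loss_collide,
    hb.collide e hp]
  ring

/-! ### Pointwise bounds, measurability and integrability of the collision kernel -/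

theorem mul_mem_Icc_of_mem (hδ : 0 < δ) {x : ℝ} (hx : x ∈ Icc 0 δ⁻¹) : δ * x ∈ Icc (0 : ℝ) 1 := by
  refine ⟨mul_nonneg hδ.le hx.1, ?_⟩
  calc δ * x ≤ δ * δ⁻¹ := by gcongr; exact hx.2
    _ = 1 := mul_inv_cancel₀ hδ.ne'

theorem sq_mul_gain (δ : ℝ) (F : E d → ℝ) (v vs : E d) (σ : S d) :
    δ ^ 2 * gain δ F v vs σ = (δ * F (post v vs σ)) * (δ * F (postStar v vs σ))
      * (1 - δ * F v) * (1 - δ * F vs) := by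
  unfold gain; ring

theorem sq_mul_loss (δ : ℝ) (F : E d → ℝ) (v vs : E d) (σ : S d) :
    δ ^ 2 * loss δ F v vs σ = (δ * F v) * (δ * F vs)
      * (1 - δ * F (post v vs σ)) * (1 - δ * F (postStar v vs σ)) := by
  unfold loss; ring

theorem prod_four_le {x y z w : ℝ} (hx : x ∈ Icc (0 : ℝ) 1) (hy : y ∈ Icc (0 : ℝ) 1)
    (hz : z ∈ Icc (0 : ℝ) 1) (hw : w ∈ Icc (0 : ℝ) 1) :
    0 ≤ x * y * z * w ∧ x * y * z * w ≤ x ∧ x * y * z * w ≤ y ∧ x * y * z * w ≤ z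
      ∧ x * y * z * w ≤ w := by
  obtain ⟨x0, x1⟩ := hx
  obtain ⟨y0, y1⟩ := hy
  obtain ⟨z0, z1⟩ := hz
  obtain ⟨w0, w1⟩ := hw
  have hxy0 := mul_nonneg x0 y0
  have hxyz0 := mul_nonneg hxy0 z0
  have hxy : x * y ≤ 1 := mul_le_one₀ x1 y0 y1
  have hxyz : x * y * z ≤ 1 := mul_le_one₀ hxy z0 z1
  have h1 : x * y * z * w ≤ x * y * z := mul_le_of_le_one_right hxyz0 w1
  have h2 : x * y * z ≤ x * y := mul_le_of_le_one_right hxy0 z1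
  exact ⟨mul_nonneg hxyz0 w0, h1.trans (h2.trans (mul_le_of_le_one_right x0 y1)),
    h1.trans (h2.trans (mul_le_of_le_one_left y0 x1)),
    h1.trans (mul_le_of_le_one_left z0 hxy), mul_le_of_le_one_left w0 hxyz⟩

theorem one_sub_mem_Icc {x : ℝ} (hx : x ∈ Icc (0 : ℝ) 1) : 1 - x ∈ Icc (0 : ℝ) 1 :=
  ⟨by linarith [hx.2], by linarith [hx.1]⟩

/-- Distance of the occupation number `δF` to the two extreme values `0` and `1`. -/
def vacancy (δ : ℝ) (F : E d → ℝ) (v : E d) : ℝ := min (δ * F v) (1 - δ * F v)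

/-- Each of the four velocities contributes the factor `δF` to one of the two products and `1 - δF`
to the other. -/
theorem min_gain_loss_le (hδ : 0 < δ) (hF : ∀ v, F v ∈ Icc 0 δ⁻¹) (v vs : E d) (σ : S d) :
    0 ≤ δ ^ 2 * gain δ F v vs σ ∧ 0 ≤ δ ^ 2 * loss δ F v vs σ ∧
    min (δ ^ 2 * gain δ F v vs σ) (δ ^ 2 * loss δ F v vs σ) ≤ vacancy δ F v ∧
    min (δ ^ 2 * gain δ F v vs σ) (δ ^ 2 * loss δ F v vs σ) ≤ vacancy δ F vs ∧
    min (δ ^ 2 * gain δ F v vs σ) (δ ^ 2 * loss δ F v vs σ) ≤ vacancy δ F (post v vs σ) ∧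
    min (δ ^ 2 * gain δ F v vs σ) (δ ^ 2 * loss δ F v vs σ) ≤ vacancy δ F (postStar v vs σ) := by
  have h := fun w => mul_mem_Icc_of_mem hδ (hF w)
  have h' := fun w => one_sub_mem_Icc (h w)
  rw [sq_mul_gain, sq_mul_loss]
  obtain ⟨g0, g1, g2, g3, g4⟩ := prod_four_le (h (post v vs σ)) (h (postStar v vs σ)) (h' v) (h' vs)
  obtain ⟨l0, l1, l2, l3, l4⟩ := prod_four_le (h v) (h vs) (h' (post v vs σ)) (h' (postStar v vs σ))
  refine ⟨g0, l0, ?_, ?_, ?_, ?_⟩ <;> refine le_min ?_ ?_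
  · exact (min_le_right _ _).trans l1
  · exact (min_le_left _ _).trans g3
  · exact (min_le_right _ _).trans l2
  · exact (min_le_left _ _).trans g4
  · exact (min_le_left _ _).trans g1
  · exact (min_le_right _ _).trans l3
  · exact (min_le_left _ _).trans g2
  · exact (min_le_right _ _).trans l4

theorem abs_gain_sub_loss_le (hδ : 0 < δ) (hF : ∀ v, F v ∈ Icc 0 δ⁻¹) (v vs : E d) (σ : S d) :
    |gain δ F v vs σ - loss δ F v vs σ| ≤ (δ ^ 2)⁻¹ := by
  have h := fun w => mul_mem_Icc_of_mem hδ (hF w)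
  have h' := fun w => one_sub_mem_Icc (h w)
  obtain ⟨g0, g1, -⟩ := prod_four_le (h (post v vs σ)) (h (postStar v vs σ)) (h' v) (h' vs)
  obtain ⟨l0, l1, -⟩ := prod_four_le (h v) (h vs) (h' (post v vs σ)) (h' (postStar v vs σ))
  rw [← sq_mul_gain] at g0 g1
  rw [← sq_mul_loss] at l0 l1
  have hδ2 : 0 < δ ^ 2 := by positivity
  have h1 : |δ ^ 2 * (gain δ F v vs σ - loss δ F v vs σ)| ≤ 1 := by
    rw [abs_le]
    constructor
    · linarith [(h v).2]
    · linarith [(h (post v vs σ)).2]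
  rw [abs_mul, abs_of_pos hδ2] at h1
  rwa [← one_div, le_div_iff₀' hδ2]

theorem measurable_gain (δ : ℝ) (hF : Measurable F) :
    Measurable fun p : E d × E d × S d => gain δ F p.1 p.2.1 p.2.2 := by
  have h1 := hF.comp (measurable_post (d := d))
  have h2 := hF.comp (measurable_postStar (d := d))
  simp only [Function.comp_def] at h1 h2
  exact ((h1.mul h2).mul (measurable_const.sub ((hF.comp measurable_fst).const_mul δ))).mul
    (measurable_const.sub ((hF.comp (measurable_fst.comp measurable_snd)).const_mul δ))

theorem measurable_loss (δ : ℝ) (hF : Measurable F) :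
    Measurable fun p : E d × E d × S d => loss δ F p.1 p.2.1 p.2.2 := by
  have h1 := hF.comp (measurable_post (d := d))
  have h2 := hF.comp (measurable_postStar (d := d))
  simp only [Function.comp_def] at h1 h2
  exact (((hF.comp measurable_fst).mul (hF.comp (measurable_fst.comp measurable_snd))).mul
    (measurable_const.sub (h1.const_mul δ))).mul (measurable_const.sub (h2.const_mul δ))

theorem measurable_crossSection (hb : IsCrossSection R b) :
    Measurable fun p : E d × E d × S d => b (p.1 - p.2.1) p.2.2 :=
  hb.measurable.comp (f := fun p : E d × E d × S d => (p.1 - p.2.1, p.2.2)) (by fun_prop)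

theorem measurable_collisionKernel (hb : IsCrossSection R b) (δ : ℝ) (hF : Measurable F) :
    Measurable (collisionKernel δ b F) :=
  ((measurable_gain δ hF).sub (measurable_loss δ hF)).mul (measurable_crossSection hb)

theorem abs_collisionKernel_le (hb : IsCrossSection R b) (hδ : 0 < δ) (hF : ∀ v, F v ∈ Icc 0 δ⁻¹)
    (p : E d × E d × S d) :
    |collisionKernel δ b F p| ≤ (δ ^ 2)⁻¹ * b (p.1 - p.2.1) p.2.2 := by
  rw [collisionKernel, collisionIntegrand, abs_mul, abs_of_nonneg (hb.nonneg _ _)]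
  gcongr
  · exact hb.nonneg _ _
  · exact abs_gain_sub_loss_le hδ hF _ _ _

theorem measurePreserving_sub_left_prod (v : E d) :
    MeasurePreserving (fun p : E d × S d => (v - p.1, p.2))
      ((volume : Measure (E d)).prod (surface d)) ((volume : Measure (E d)).prod (surface d)) :=
  (Measure.measurePreserving_sub_left volume v).prod (MeasurePreserving.id (surface d))

theorem integrable_crossSection_sub (hb : IsCrossSection R b) (v : E d) :
    Integrable (fun p : E d × S d => b (v - p.1) p.2)
      ((volume : Measure (E d)).prod (surface d)) :=
  (measurePreserving_sub_left_prod v).integrable_comp_of_integrable hb.integrable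

theorem integral_crossSection_sub (hb : IsCrossSection R b) (v : E d) :
    ∫ p : E d × S d, b (v - p.1) p.2 ∂((volume : Measure (E d)).prod (surface d))
      = ∫ p : E d × S d, b p.1 p.2 ∂((volume : Measure (E d)).prod (surface d)) := by
  have hmp := measurePreserving_sub_left_prod v
  have h := integral_map (μ := (volume : Measure (E d)).prod (surface d)) hmp.aemeasurable
    (f := Function.uncurry b) hb.measurable.aestronglyMeasurable
  rw [hmp.map_eq] at h
  exact h.symm

theorem integrable_collisionIntegrand (hb : IsCrossSection R b) (hδ : 0 < δ) (hFm : Measurable F)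
    (hF : ∀ v, F v ∈ Icc 0 δ⁻¹) (v : E d) :
    Integrable (collisionIntegrand δ b F v) ((volume : Measure (E d)).prod (surface d)) := by
  refine Integrable.mono' ((integrable_crossSection_sub hb v).const_mul (δ ^ 2)⁻¹) ?_
    (Eventually.of_forall fun p => abs_collisionKernel_le hb hδ hF (v, p))
  exact ((measurable_collisionKernel hb δ hFm).comp measurable_prodMk_left).aestronglyMeasurable

theorem abs_collision_le (hb : IsCrossSection R b) (hδ : 0 < δ) (hF : ∀ v, F v ∈ Icc 0 δ⁻¹)
    (v : E d) :
    |collision δ b F v| ≤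
      (δ ^ 2)⁻¹ * ∫ p : E d × S d, b p.1 p.2 ∂((volume : Measure (E d)).prod (surface d)) := by
  rw [← integral_crossSection_sub hb v, ← integral_const_mul]
  exact norm_integral_le_of_norm_le (f := collisionIntegrand δ b F v)
    ((integrable_crossSection_sub hb v).const_mul (δ ^ 2)⁻¹)
    (Eventually.of_forall fun p => abs_collisionKernel_le hb hδ hF (v, p))

theorem measurable_collision (hb : IsCrossSection R b) (δ : ℝ) (hFm : Measurable F) :
    Measurable (collision δ b F) :=
  ((measurable_collisionKernel hb δ hFm).stronglyMeasurable.integral_prod_right').measurable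

end Kernel

/-! ### The truncated energy -/

theorem measurable_energy (R τ ε : ℝ) : Measurable (energy R τ ε : E d → ℝ) := by
  unfold energy; fun_prop

/-- The energy variable truncated to `|u| < L`. -/
def truncEnergy (R τ ε L : ℝ) (v : E d) : ℝ :=
  if |energy R τ ε v| < L then energy R τ ε v else 0

theorem measurable_truncEnergy (R τ ε L : ℝ) : Measurable (truncEnergy R τ ε L : E d → ℝ) :=
  Measurable.ite (measurableSet_lt (measurable_energy R τ ε).abs measurable_const)
    (measurable_energy R τ ε) measurable_const

theorem defectIntegrand_eq {δ R τ α ε : ℝ} (hε : 0 < ε) (b : E d → S d → ℝ) (F : E d → ℝ) (v : E d) :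
    defectIntegrand δ R τ α ε b F v
      = truncEnergy R τ ε (-Real.log (ε ^ α)) v * collision δ b F v := by
  have h : |‖v‖ ^ 2 - R ^ 2| / ε ^ τ = |energy R τ ε v| := by
    rw [energy, abs_div, abs_of_pos (Real.rpow_pos_of_pos hε τ)]
  unfold defectIntegrand cutoff truncEnergy
  simp only [indicator, mem_ofPred_eq, h, Pi.one_apply]
  split_ifs <;> ring

theorem abs_truncEnergy_le {R τ ε L : ℝ} (hL : 0 ≤ L) (v : E d) :
    |truncEnergy R τ ε L v| ≤ L := by
  unfold truncEnergy
  split_ifs with h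
  · exact h.le
  · simpa using hL

theorem integrable_truncEnergy {R τ ε : ℝ} (hε : 0 < ε) (L : ℝ) :
    Integrable (truncEnergy R τ ε L : E d → ℝ) := by
  rcases lt_or_ge L 0 with hL | hL
  · have : (truncEnergy R τ ε L : E d → ℝ) = fun _ => 0 := by
      ext v
      rw [truncEnergy, if_neg (by linarith [abs_nonneg (energy R τ ε v)])]
    rw [this]; exact integrable_zero _ _ _
  have hετ := Real.rpow_pos_of_pos hε τ
  -- A crude radius: it is at least `1`, so beyond it `|v|² ≥ |v| > R² + ε^τ L`.
  have hsupp : ∀ v : E d, v ∉ Metric.closedBall (0 : E d) (R ^ 2 + ε ^ τ * L + 1) →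
      truncEnergy R τ ε L v = 0 := by
    intro v hv
    rw [mem_closedBall_zero_iff, not_le] at hv
    rw [truncEnergy, if_neg]
    rw [energy, not_lt]
    refine le_trans ?_ (le_abs_self _)
    rw [le_div_iff₀ hετ]
    have h0 : 0 ≤ ε ^ τ * L := by positivity
    have h1 : 1 ≤ ‖v‖ := by nlinarith [sq_nonneg R]
    nlinarith
  refine IntegrableOn.integrable_of_forall_notMem_eq_zero ?_ hsupp
  refine Measure.integrableOn_of_bounded (M := L) measure_closedBall_lt_top.ne
    (measurable_truncEnergy R τ ε L).aestronglyMeasurable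
    (Eventually.of_forall fun v => abs_truncEnergy_le hL v)

/-! ### Symmetrization -/

theorem lintegral_crossSection_sub {R : ℝ} {b : E d → S d → ℝ} (hb : IsCrossSection R b) (v : E d) :
    ∫⁻ vs, ∫⁻ σ, ENNReal.ofReal (b (v - vs) σ) ∂(surface d)
      = ∫⁻ p : E d × S d, ENNReal.ofReal (b p.1 p.2)
          ∂((volume : Measure (E d)).prod (surface d)) := by
  rw [lintegral_sub_left_eq_self (fun z => ∫⁻ σ, ENNReal.ofReal (b z σ) ∂(surface d)) v,
    lintegral_prod (fun p : E d × S d => ENNReal.ofReal (b p.1 p.2))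
      hb.measurable.ennreal_ofReal.aemeasurable]

section Symmetrization

variable {R δ : ℝ} {b : E d → S d → ℝ} {F φ : E d → ℝ}

/-- The kernel is dominated by `δ⁻² b(v - v_*, σ)`, whose integral in `(v_*, σ)` is finite and
independent of `v`. This makes it legitimate to split the symmetrized integral into four terms. -/
theorem integrable_mul_collisionKernel (hb : IsCrossSection R b) (hδ : 0 < δ) (hFm : Measurable F)
    (hF : ∀ v, F v ∈ Icc 0 δ⁻¹) (hφm : Measurable φ) (hφ : Integrable φ) :
    Integrable (fun p => φ p.1 * collisionKernel δ b F p) (collisionMeasure d) := by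
  have hmb : Measurable fun p : E d × E d × S d => φ p.1 * b (p.1 - p.2.1) p.2.2 :=
    (hφm.comp measurable_fst).mul (measurable_crossSection hb)
  have hdom : Integrable (fun p : E d × E d × S d => φ p.1 * b (p.1 - p.2.1) p.2.2)
      (collisionMeasure d) := by
    refine ⟨hmb.aestronglyMeasurable, ?_⟩
    rw [HasFiniteIntegral, lintegral_collisionMeasure
      (g := fun p : E d × E d × S d => ‖φ p.1 * b (p.1 - p.2.1) p.2.2‖ₑ) hmb.enorm]
    have hfin : ∫⁻ p : E d × S d, ENNReal.ofReal (b p.1 p.2)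
        ∂((volume : Measure (E d)).prod (surface d)) < ⊤ := by
      rw [← ofReal_integral_eq_lintegral_ofReal (f := fun p : E d × S d => b p.1 p.2) hb.integrable
        (Eventually.of_forall fun p => hb.nonneg p.1 p.2)]
      exact ENNReal.ofReal_lt_top
    have hinner : ∀ v : E d, ∫⁻ vs, ∫⁻ σ, ‖φ v * b (v - vs) σ‖ₑ ∂(surface d)
        = ‖φ v‖ₑ * ∫⁻ p : E d × S d, ENNReal.ofReal (b p.1 p.2)
            ∂((volume : Measure (E d)).prod (surface d)) := by
      intro v
      rw [← lintegral_crossSection_sub hb v, ← lintegral_const_mul' _ _ enorm_ne_top]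
      refine lintegral_congr fun vs => ?_
      rw [← lintegral_const_mul' _ _ enorm_ne_top]
      refine lintegral_congr fun σ => ?_
      rw [enorm_mul, Real.enorm_of_nonneg (hb.nonneg _ _)]
    simp_rw [hinner]
    rw [lintegral_mul_const' _ _ hfin.ne]
    exact ENNReal.mul_lt_top hφ.hasFiniteIntegral hfin
  refine Integrable.mono (hdom.const_mul (δ ^ 2)⁻¹)
    ((hφm.comp measurable_fst).mul (measurable_collisionKernel hb δ hFm)).aestronglyMeasurable
    (Eventually.of_forall fun p => ?_)
  have h := abs_collisionKernel_le hb hδ hF p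
  have hδ2 : 0 ≤ (δ ^ 2)⁻¹ := by positivity
  simp only [Real.norm_eq_abs, abs_mul, abs_of_nonneg hδ2, abs_of_nonneg (hb.nonneg _ _)]
  calc |φ p.1| * |collisionKernel δ b F p|
      ≤ |φ p.1| * ((δ ^ 2)⁻¹ * b (p.1 - p.2.1) p.2.2) := by gcongr
    _ = _ := by ring

theorem integral_comp_measurePreserving {α β : Type*} [MeasurableSpace α]
    [MeasurableSpace β] {μ : Measure α} {ν : Measure β} {T : α → β} (hT : MeasurePreserving T μ ν)
    {f : β → ℝ} (hf : AEStronglyMeasurable f ν) : ∫ x, f (T x) ∂μ = ∫ y, f y ∂ν := by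
  have h := integral_map (μ := μ) hT.aemeasurable (f := f) (by rwa [hT.map_eq])
  rw [hT.map_eq] at h
  exact h.symm

/-- Weak form of the collision operator, symmetrized over the collision group. -/
theorem integral_mul_collision (e : S d) [Nontrivial (E d)] (hb : IsCrossSection R b) (hδ : 0 < δ)
    (hFm : Measurable F) (hF : ∀ v, F v ∈ Icc 0 δ⁻¹) (hφm : Measurable φ) (hφ : Integrable φ) :
    ∫ v, φ v * collision δ b F v = (1 / 4) * ∫ p, (φ p.1 + φ p.2.1
        - φ (post p.1 p.2.1 p.2.2) - φ (postStar p.1 p.2.1 p.2.2))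
        * collisionKernel δ b F p ∂(collisionMeasure d) := by
  have hi := integrable_mul_collisionKernel hb hδ hFm hF hφm hφ
  have hs := measurePreserving_swapParticles (d := d)
  have hc := measurePreserving_collide (d := d) e
  have hne := ae_collisionMeasure_sub_ne_zero (d := d)
  have is : Integrable (fun p => φ p.2.1 * collisionKernel δ b F p) (collisionMeasure d) := by
    refine (hs.integrable_comp_of_integrable hi).congr ?_
    filter_upwards [hne] with p hp
    simp only [Function.comp, collisionKernel_swap hb δ F hp]
    rfl
  have es : ∫ p, φ p.2.1 * collisionKernel δ b F p ∂(collisionMeasure d)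
      = ∫ p, φ p.1 * collisionKernel δ b F p ∂(collisionMeasure d) := by
    rw [← integral_comp_measurePreserving hs hi.aestronglyMeasurable]
    refine integral_congr_ae ?_
    filter_upwards [hne] with p hp
    simp only [collisionKernel_swap hb δ F hp]
    rfl
  -- A collision exchanges gain and loss and so reverses the sign of the kernel; hence the minus
  -- signs at the post-collisional velocities.
  have hcoll : ∀ g : E d × E d × S d → ℝ,
      Integrable (fun p => g p * collisionKernel δ b F p) (collisionMeasure d) →
      Integrable (fun p => g (collide e p) * collisionKernel δ b F p) (collisionMeasure d) ∧
      ∫ p, g (collide e p) * collisionKernel δ b F p ∂(collisionMeasure d)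
        = -∫ p, g p * collisionKernel δ b F p ∂(collisionMeasure d) := by
    intro g hg
    constructor
    · refine (hc.integrable_comp_of_integrable hg.neg).congr ?_
      filter_upwards [hne] with p hp
      simp [collisionKernel_collide hb e δ F hp]
    · rw [← integral_neg', ← integral_comp_measurePreserving hc hg.neg.aestronglyMeasurable]
      refine integral_congr_ae ?_
      filter_upwards [hne] with p hp
      simp [collisionKernel_collide hb e δ F hp]
  obtain ⟨ic, ec⟩ := hcoll (fun p => φ p.1) hi
  obtain ⟨ics, ecs⟩ := hcoll (fun p => φ p.2.1) is
  have h0 : ∫ v, φ v * collision δ b F v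
      = ∫ p, φ p.1 * collisionKernel δ b F p ∂(collisionMeasure d) := by
    unfold collisionMeasure at hi ⊢
    rw [integral_prod _ hi]
    refine integral_congr_ae (Eventually.of_forall fun v => ?_)
    simp only [collisionKernel, collision, integral_const_mul]
  have hsplit : ∫ p, (φ p.1 + φ p.2.1 - φ (post p.1 p.2.1 p.2.2) - φ (postStar p.1 p.2.1 p.2.2))
        * collisionKernel δ b F p ∂(collisionMeasure d)
      = ∫ p, φ p.1 * collisionKernel δ b F p ∂(collisionMeasure d)
      + ∫ p, φ p.2.1 * collisionKernel δ b F p ∂(collisionMeasure d)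
      - ∫ p, φ (collide e p).1 * collisionKernel δ b F p ∂(collisionMeasure d)
      - ∫ p, φ (collide e p).2.1 * collisionKernel δ b F p ∂(collisionMeasure d) := by
    rw [← integral_add' hi is, ← integral_sub' (hi.add is) ic,
      ← integral_sub' ((hi.add is).sub ic) ics]
    refine integral_congr_ae (Eventually.of_forall fun p => ?_)
    simp only [collide, Pi.add_apply, Pi.sub_apply]
    ring
  rw [h0, hsplit, ec, ecs, es]
  ring

end Symmetrization

/-! ### Collisions leaving or entering the truncation -/

/-- The vacancy of a velocity `v` of energy at least `L` whose partner `v_*` has an energy confined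
to an interval. -/
def exitWeight (δ R τ ε L : ℝ) (F : E d → ℝ) (v vs : E d) : ℝ≥0∞ :=
  if L ≤ |energy R τ ε v| ∧
    (|energy R τ ε vs| < L ∨ |energy R τ ε v + energy R τ ε vs| < 2 * L)
  then ENNReal.ofReal (vacancy δ F v) else 0

/-- The collision rate of the pairs weighted by `exitWeight`. -/
def exitRate (δ R τ ε L : ℝ) (b : E d → S d → ℝ) (F : E d → ℝ) (p : E d × E d × S d) : ℝ≥0∞ :=
  exitWeight δ R τ ε L F p.1 p.2.1 * ENNReal.ofReal (b (p.1 - p.2.1) p.2.2)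

/-- The density of the entropy dissipation. -/
def dissipationRate (δ : ℝ) (b : E d → S d → ℝ) (F : E d → ℝ) (p : E d × E d × S d) : ℝ≥0∞ :=
  dissipationFun (δ ^ 2 * gain δ F p.1 p.2.1 p.2.2) (δ ^ 2 * loss δ F p.1 p.2.1 p.2.2) *
    ENNReal.ofReal (b (p.1 - p.2.1) p.2.2)

section Exit

variable {R δ τ ε L : ℝ} {b : E d → S d → ℝ} {F : E d → ℝ}

theorem measurable_vacancy (δ : ℝ) (hF : Measurable F) : Measurable (vacancy δ F) :=
  (hF.const_mul δ).min (measurable_const.sub (hF.const_mul δ))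

theorem measurable_exitRate (R δ τ ε L : ℝ) (hb : IsCrossSection R b) (hF : Measurable F) :
    Measurable (exitRate δ R τ ε L b F) := by
  have hu := measurable_energy (d := d) R τ ε
  have h1 : Measurable fun p : E d × E d × S d => energy R τ ε p.1 := hu.comp measurable_fst
  have h2 : Measurable fun p : E d × E d × S d => energy R τ ε p.2.1 :=
    hu.comp (measurable_fst.comp measurable_snd)
  refine Measurable.mul (Measurable.ite ?_ ?_ measurable_const)
    (measurable_crossSection hb).ennreal_ofReal
  · exact (measurableSet_le measurable_const h1.abs).inter
      ((measurableSet_lt h2.abs measurable_const).union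
        (measurableSet_lt (h1.add h2).abs measurable_const))
  · exact ((measurable_vacancy δ hF).comp measurable_fst).ennreal_ofReal

theorem measurable_dissipationFun : Measurable fun q : ℝ × ℝ => dissipationFun q.1 q.2 := by
  unfold dissipationFun
  refine Measurable.ite (measurableSet_eq_fun measurable_fst measurable_snd) measurable_const
    (Measurable.ite ?_ measurable_const (by fun_prop))
  exact (measurable_fst (measurableSet_singleton 0)).union
    (measurable_snd (measurableSet_singleton 0))

theorem measurable_dissipationRate (δ : ℝ) (hb : IsCrossSection R b) (hF : Measurable F) :
    Measurable (dissipationRate δ b F) :=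
  (measurable_dissipationFun.comp (((measurable_gain δ hF).const_mul (δ ^ 2)).prodMk
    ((measurable_loss δ hF).const_mul (δ ^ 2)))).mul (measurable_crossSection hb).ennreal_ofReal

theorem le_exitWeight_sum (hδ : 0 < δ) (hF : ∀ v, F v ∈ Icc 0 δ⁻¹) {v vs : E d} {σ : S d}
    (hw : truncEnergy R τ ε L v + truncEnergy R τ ε L vs
      - truncEnergy R τ ε L (post v vs σ) - truncEnergy R τ ε L (postStar v vs σ) ≠ 0) :
    ENNReal.ofReal (min (δ ^ 2 * gain δ F v vs σ) (δ ^ 2 * loss δ F v vs σ))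
      ≤ exitWeight δ R τ ε L F v vs + exitWeight δ R τ ε L F vs v
        + exitWeight δ R τ ε L F (post v vs σ) (postStar v vs σ)
        + exitWeight δ R τ ε L F (postStar v vs σ) (post v vs σ) := by
  obtain ⟨-, -, m1, m2, m3, m4⟩ := min_gain_loss_le hδ hF v vs σ
  have key : ∀ x y : E d,
      min (δ ^ 2 * gain δ F v vs σ) (δ ^ 2 * loss δ F v vs σ) ≤ vacancy δ F x →
      (L ≤ |energy R τ ε x| ∧
        (|energy R τ ε y| < L ∨ |energy R τ ε x + energy R τ ε y| < 2 * L)) →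
      ENNReal.ofReal (min (δ ^ 2 * gain δ F v vs σ) (δ ^ 2 * loss δ F v vs σ))
        ≤ exitWeight δ R τ ε L F x y := by
    intro x y hm h
    rw [exitWeight, if_pos h]
    exact ENNReal.ofReal_le_ofReal hm
  rcases exists_energy_confined (energy_post_add R τ ε v vs σ).symm hw with h | h | h | h
  · exact (key _ _ m1 h).trans (by rw [add_assoc, add_assoc]; exact le_self_add)
  · exact (key _ _ m2 h).trans ((le_add_self.trans le_self_add).trans le_self_add)
  · exact (key _ _ m3 h).trans (le_add_self.trans le_self_add)
  · exact (key _ _ m4 h).trans le_add_self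

/-- By the invariance of `b`, the four exit weights times `b` are values of the single function
`exitRate` at images of `p` under measure-preserving maps, so that they all have the same integral.
-/
theorem enorm_truncEnergy_balance_mul_le (e : S d) (hb : IsCrossSection R b) (hδ : 0 < δ)
    (hF : ∀ v, F v ∈ Icc 0 δ⁻¹) (hL : 0 ≤ L) {θ : ℝ} (hθ : 0 < θ) {p : E d × E d × S d}
    (hp : p.1 - p.2.1 ≠ 0) :
    ‖(truncEnergy R τ ε L p.1 + truncEnergy R τ ε L p.2.1
        - truncEnergy R τ ε L (post p.1 p.2.1 p.2.2)
        - truncEnergy R τ ε L (postStar p.1 p.2.1 p.2.2)) * collisionKernel δ b F p‖ₑ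
      ≤ ENNReal.ofReal (4 * L * (δ ^ 2)⁻¹) *
        (ENNReal.ofReal θ * (exitRate δ R τ ε L b F p + exitRate δ R τ ε L b F (swapParticles p)
          + exitRate δ R τ ε L b F (collide e p)
          + exitRate δ R τ ε L b F (swapParticles (collide e p)))
        + ENNReal.ofReal (1 + θ⁻¹) * dissipationRate δ b F p) := by
  set w := truncEnergy R τ ε L p.1 + truncEnergy R τ ε L p.2.1
        - truncEnergy R τ ε L (post p.1 p.2.1 p.2.2)
        - truncEnergy R τ ε L (postStar p.1 p.2.1 p.2.2) with hw
  by_cases h0 : w = 0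
  · simp [h0]
  have hwL : |w| ≤ 4 * L := by
    have h1 := abs_le.1 (abs_truncEnergy_le (R := R) (τ := τ) (ε := ε) hL p.1)
    have h2 := abs_le.1 (abs_truncEnergy_le (R := R) (τ := τ) (ε := ε) hL p.2.1)
    have h3 := abs_le.1 (abs_truncEnergy_le (R := R) (τ := τ) (ε := ε) hL (post p.1 p.2.1 p.2.2))
    have h4 := abs_le.1
      (abs_truncEnergy_le (R := R) (τ := τ) (ε := ε) hL (postStar p.1 p.2.1 p.2.2))
    rw [abs_le]
    constructor <;> linarith
  have hp' : (collide e p).1 - (collide e p).2.1 ≠ 0 := by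
    simp only [collide, post_sub_postStar]
    rw [← norm_ne_zero_iff, norm_smul, norm_sphere]
    simpa using hp
  have hb1 : b (p.2.1 - p.1) (-p.2.2) = b (p.1 - p.2.1) p.2.2 := hb.swap hp _
  have hb2 : b ((collide e p).1 - (collide e p).2.1) (collide e p).2.2 = b (p.1 - p.2.1) p.2.2 :=
    hb.collide e hp _
  have hb3 : b ((collide e p).2.1 - (collide e p).1) (-(collide e p).2.2)
      = b (p.1 - p.2.1) p.2.2 := (hb.swap hp' _).trans hb2
  obtain ⟨hY, hZ, -⟩ := min_gain_loss_le hδ hF p.1 p.2.1 p.2.2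
  have hmin := le_exitWeight_sum (R := R) (τ := τ) (ε := ε) (L := L) hδ hF (σ := p.2.2) h0
  have hdiss := abs_sub_le_min_add_dissipationFun hY hZ hθ
  have hδ2 : 0 < δ ^ 2 := by positivity
  have hkernel : |w * collisionKernel δ b F p| = |w| * (δ ^ 2)⁻¹
      * (|δ ^ 2 * gain δ F p.1 p.2.1 p.2.2 - δ ^ 2 * loss δ F p.1 p.2.1 p.2.2|
        * b (p.1 - p.2.1) p.2.2) := by
    rw [collisionKernel, collisionIntegrand, ← mul_sub, abs_mul, abs_mul, abs_mul,
      abs_of_pos hδ2, abs_of_nonneg (hb.nonneg _ _)]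
    field_simp
  rw [Real.enorm_eq_ofReal_abs, hkernel,
    ENNReal.ofReal_mul (p := |w| * (δ ^ 2)⁻¹) (by positivity),
    ENNReal.ofReal_mul
      (p := |δ ^ 2 * gain δ F p.1 p.2.1 p.2.2 - δ ^ 2 * loss δ F p.1 p.2.1 p.2.2|) (abs_nonneg _)]
  refine mul_le_mul' (ENNReal.ofReal_le_ofReal (by gcongr)) ?_
  refine (mul_le_mul' (hdiss.trans (add_le_add_left (mul_le_mul' le_rfl hmin) _)) le_rfl).trans
    (le_of_eq ?_)
  simp only [exitRate, swapParticles, dissipationRate, hb1, hb2, hb3]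
  simp only [collide]
  ring

/-- Bound of the truncated energy production by the vacancies outside the truncation and the
entropy dissipation. -/
theorem enorm_integral_truncEnergy_mul_collision_le (e : S d) [Nontrivial (E d)]
    (hb : IsCrossSection R b) (hδ : 0 < δ) (hε : 0 < ε) (hFm : Measurable F)
    (hF : ∀ v, F v ∈ Icc 0 δ⁻¹) (hL : 0 ≤ L) {θ : ℝ} (hθ : 0 < θ) :
    ‖∫ v, truncEnergy R τ ε L v * collision δ b F v‖ₑ ≤
      ENNReal.ofReal (4 * L * (δ ^ 2)⁻¹) *
        (ENNReal.ofReal θ * (4 * ∫⁻ p, exitRate δ R τ ε L b F p ∂(collisionMeasure d))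
        + ENNReal.ofReal (1 + θ⁻¹) * ∫⁻ p, dissipationRate δ b F p ∂(collisionMeasure d)) := by
  have hs := measurePreserving_swapParticles (d := d)
  have hc := measurePreserving_collide (d := d) e
  have hG := measurable_exitRate R δ τ ε L hb hFm
  have hGs : Measurable fun p => exitRate δ R τ ε L b F (swapParticles p) := hG.comp hs.measurable
  have hGc : Measurable fun p => exitRate δ R τ ε L b F (collide e p) := hG.comp hc.measurable
  have hGsc : Measurable fun p => exitRate δ R τ ε L b F (swapParticles (collide e p)) :=
    hGs.comp hc.measurable
  have hD := measurable_dissipationRate δ hb hFm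
  rw [integral_mul_collision e hb hδ hFm hF (measurable_truncEnergy R τ ε L)
    (integrable_truncEnergy hε L), enorm_mul]
  have h14 : ‖(1 / 4 : ℝ)‖ₑ ≤ 1 := by
    rw [Real.enorm_of_nonneg (by norm_num)]
    exact ENNReal.ofReal_le_one.2 (by norm_num)
  refine (mul_le_mul' h14 (enorm_integral_le_lintegral_enorm _)).trans ?_
  rw [one_mul]
  refine (lintegral_mono_ae ((ae_collisionMeasure_sub_ne_zero (d := d)).mono fun p hp =>
    enorm_truncEnergy_balance_mul_le e hb hδ hF hL hθ hp)).trans (le_of_eq ?_)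
  rw [lintegral_const_mul' _ _ ENNReal.ofReal_ne_top, lintegral_add_right _ (hD.const_mul _),
    lintegral_const_mul' _ _ ENNReal.ofReal_ne_top, lintegral_const_mul' _ _ ENNReal.ofReal_ne_top,
    lintegral_add_right _ hGsc, lintegral_add_right _ hGc, lintegral_add_right _ hGs]
  have e1 := hs.lintegral_comp hG
  have e2 := hc.lintegral_comp hG
  have e3 := hc.lintegral_comp hGs
  rw [e3, e2, e1]
  ring

end Exit

/-! ### Entropy control of the vacancies outside the truncation -/

/-- The vacancy restricted to the energies of modulus at least `L`. -/
def outerVacancy (δ R τ ε L : ℝ) (F : E d → ℝ) (v : E d) : ℝ≥0∞ :=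
  if L ≤ |energy R τ ε v| then ENNReal.ofReal (vacancy δ F v) else 0

/-- The volume of the unit ball, the mass of the sphere and the bound of the cross-section, as they
enter the bound of `exitRate`. -/
def exitConstant (R : ℝ) (b : E d → S d → ℝ) : ℝ≥0∞ :=
  eLpNorm (Function.uncurry b) ⊤ ((volume : Measure (E d)).prod (surface d)) *
    (ENNReal.ofReal (6 * d * √(2 * R ^ 2 + 2) ^ (d - 2)) * volume (Metric.ball (0 : E d) 1)
      * surface d univ)

theorem exitConstant_ne_top {R : ℝ} {b : E d → S d → ℝ} (hb : IsCrossSection R b) :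
    exitConstant R b ≠ ⊤ :=
  ENNReal.mul_ne_top hb.bounded.eLpNorm_ne_top (ENNReal.mul_ne_top
    (ENNReal.mul_ne_top ENNReal.ofReal_ne_top measure_ball_lt_top.ne) (measure_ne_top _ _))

/-- The alternatives are shells in `|v_*|²`, centred at `R²` and `2R² - |v|²`, of half-widths `ε^τ
L` and `2 ε^τ L`; hence `6d = 2d + 4d`. Both lie below `2R² + 2` whatever `v` is, which makes the
bound uniform in `v`. -/
theorem volume_confined_le (hd : 2 ≤ d) {R τ ε L : ℝ} (hε : 0 < ε) (hL : 0 ≤ L)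
    (hL1 : ε ^ τ * L ≤ 1) (v : E d) :
    volume {vs : E d | |energy R τ ε vs| < L ∨ |energy R τ ε v + energy R τ ε vs| < 2 * L}
      ≤ ENNReal.ofReal (6 * d * √(2 * R ^ 2 + 2) ^ (d - 2)) * volume (Metric.ball (0 : E d) 1)
        * ENNReal.ofReal (ε ^ τ * L) := by
  have hετ := Real.rpow_pos_of_pos hε τ
  have hsub : {vs : E d | |energy R τ ε vs| < L ∨ |energy R τ ε v + energy R τ ε vs| < 2 * L}
      ⊆ {vs : E d | |‖vs‖ ^ 2 - R ^ 2| < ε ^ τ * L}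
        ∪ {vs : E d | |‖vs‖ ^ 2 - (2 * R ^ 2 - ‖v‖ ^ 2)| < 2 * (ε ^ τ * L)} := by
    rintro vs (h | h)
    · left
      rw [energy, abs_div, abs_of_pos hετ, div_lt_iff₀' hετ] at h
      exact h
    · right
      rw [energy, energy, ← add_div, abs_div, abs_of_pos hετ, div_lt_iff₀' hετ] at h
      rw [mem_ofPred_eq]
      calc |‖vs‖ ^ 2 - (2 * R ^ 2 - ‖v‖ ^ 2)|
          = |‖v‖ ^ 2 - R ^ 2 + (‖vs‖ ^ 2 - R ^ 2)| := by congr 1; ring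
        _ < _ := by linarith
  have hP : √(2 * R ^ 2 + 2) ^ 2 = 2 * R ^ 2 + 2 := Real.sq_sqrt (by positivity)
  have h0 : 0 ≤ ε ^ τ * L := by positivity
  have h1 := volume_shell_le hd (A := R ^ 2) (h := ε ^ τ * L) (Real.sqrt_nonneg (2 * R ^ 2 + 2))
    (by rw [hP]; nlinarith [sq_nonneg R])
  have h2 := volume_shell_le hd (A := 2 * R ^ 2 - ‖v‖ ^ 2) (h := 2 * (ε ^ τ * L))
    (Real.sqrt_nonneg (2 * R ^ 2 + 2)) (by rw [hP]; nlinarith [sq_nonneg ‖v‖])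
  refine (measure_mono hsub).trans ((measure_union_le _ _).trans ((add_le_add h1 h2).trans ?_))
  rw [← add_mul, ← ENNReal.ofReal_add (by positivity) (by positivity),
    mul_right_comm (ENNReal.ofReal _), ← ENNReal.ofReal_mul (by positivity)]
  refine le_of_eq ?_
  congr 2
  ring

/-- For fixed `v` the partner ranges over a set of volume `O(ε^τ L)`, on which `b` is replaced by
its essential supremum. -/
theorem lintegral_exitRate_le (hd : 2 ≤ d) {δ R τ ε L : ℝ} {b : E d → S d → ℝ} {F : E d → ℝ}
    (hb : IsCrossSection R b) (hFm : Measurable F) (hε : 0 < ε) (hL : 0 ≤ L)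
    (hL1 : ε ^ τ * L ≤ 1) :
    ∫⁻ p, exitRate δ R τ ε L b F p ∂(collisionMeasure d)
      ≤ exitConstant R b * ENNReal.ofReal (ε ^ τ * L) * ∫⁻ v, outerVacancy δ R τ ε L F v := by
  rw [collisionMeasure, lintegral_prod _ (measurable_exitRate R δ τ ε L hb hFm).aemeasurable,
    ← lintegral_const_mul' _ _ (ENNReal.mul_ne_top (exitConstant_ne_top hb) ENNReal.ofReal_ne_top)]
  refine lintegral_mono fun v => ?_
  set A := {vs : E d | |energy R τ ε vs| < L ∨ |energy R τ ε v + energy R τ ε vs| < 2 * L} with hA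
  have hu := measurable_energy (d := d) R τ ε
  have hAm : MeasurableSet A :=
    (measurableSet_lt hu.abs measurable_const).union
      (measurableSet_lt (measurable_const.add hu).abs measurable_const)
  set B := eLpNorm (Function.uncurry b) ⊤ ((volume : Measure (E d)).prod (surface d)) with hB
  have hbB : ∀ᵐ q : E d × S d ∂((volume : Measure (E d)).prod (surface d)),
      ENNReal.ofReal (b (v - q.1) q.2) ≤ B := by
    have h := ae_le_eLpNormEssSup (f := Function.uncurry b)
      (μ := (volume : Measure (E d)).prod (surface d))
    filter_upwards [(measurePreserving_sub_left_prod v).quasiMeasurePreserving.ae h] with q hq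
    rw [hB, eLpNorm_exponent_top, ← Real.enorm_of_nonneg (hb.nonneg _ _)]
    exact hq
  have hbound : ∀ᵐ q : E d × S d ∂((volume : Measure (E d)).prod (surface d)),
      exitRate δ R τ ε L b F (v, q)
        ≤ outerVacancy δ R τ ε L F v * (A ×ˢ univ).indicator (fun _ => B) q := by
    filter_upwards [hbB] with q hq
    unfold exitRate exitWeight outerVacancy
    by_cases h1 : L ≤ |energy R τ ε v|
    · by_cases h2 : q.1 ∈ A
      · rw [if_pos ⟨h1, h2⟩, if_pos h1, indicator_of_mem (by simpa using h2)]
        exact mul_le_mul' le_rfl hq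
      · rw [if_neg fun h => h2 h.2, zero_mul]
        exact zero_le
    · rw [if_neg fun h => h1 h.1, zero_mul]
      exact zero_le
  refine (lintegral_mono_ae hbound).trans ?_
  have hov : outerVacancy δ R τ ε L F v ≠ ⊤ := by
    unfold outerVacancy
    split_ifs <;> simp
  rw [lintegral_const_mul' _ _ hov, lintegral_indicator_const (hAm.prod MeasurableSet.univ),
    Measure.prod_prod, mul_comm]
  refine mul_le_mul' ?_ le_rfl
  have := volume_confined_le hd (R := R) hε hL hL1 v
  calc B * (volume A * surface d univ) ≤ B * ((ENNReal.ofReal (6 * d * √(2 * R ^ 2 + 2) ^ (d - 2))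
        * volume (Metric.ball (0 : E d) 1) * ENNReal.ofReal (ε ^ τ * L)) * surface d univ) := by
        gcongr
    _ = _ := by rw [exitConstant]; ring

/-- The mass of the Gaussian `exp((R² - |v|²)/4)`. -/
def gaussianMass (d : ℕ) (R : ℝ) : ℝ≥0∞ :=
  ∫⁻ v : E d, ENNReal.ofReal (Real.exp ((R ^ 2 - ‖v‖ ^ 2) / 4))

theorem gaussianMass_ne_top (d : ℕ) (R : ℝ) : gaussianMass d R ≠ ⊤ := by
  have h : Integrable fun v : E d => Real.exp ((R ^ 2 - ‖v‖ ^ 2) / 4) := by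
    have h1 := (GaussianFourier.integrable_cexp_neg_mul_sq_norm_add (V := E d) (b := 1 / 4)
      (by norm_num) 0 0).norm.const_mul (Real.exp (R ^ 2 / 4))
    refine h1.congr (Eventually.of_forall fun v => ?_)
    simp only [Complex.norm_exp]
    rw [← Real.exp_add]
    congr 1
    simp [← Complex.ofReal_pow]
    ring
  rw [gaussianMass, ← ofReal_integral_eq_lintegral_ofReal h
    (Eventually.of_forall fun v => (Real.exp_pos _).le)]
  exact ENNReal.ofReal_ne_top

/-- The remainder `e^(-|u|/2)` is shared out: half of the exponent uses `|u| ≥ L` and gives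
smallness, the other half uses `|u| ≥ |v|² - R²`, valid as `ε^τ ≤ 1`, and gives integrability in
`v`. -/
theorem mul_outerVacancy_le {δ R τ ε L : ℝ} {F : E d → ℝ} (hδ : 0 < δ)
    (hF : ∀ v, F v ∈ Icc 0 δ⁻¹) (hτ : 0 ≤ τ) (hε : 0 < ε) (hε1 : ε ≤ 1) (hL : 0 ≤ L) (v : E d) :
    ENNReal.ofReal (L / 2) * outerVacancy δ R τ ε L F v
      ≤ ENNReal.ofReal (entropyFun (δ * F v) (δ * fermiDirac δ R τ ε v))
        + ENNReal.ofReal (Real.exp (-(L / 4)))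
          * ENNReal.ofReal (Real.exp ((R ^ 2 - ‖v‖ ^ 2) / 4)) := by
  unfold outerVacancy
  split_ifs with h
  · rw [← ENNReal.ofReal_mul (by positivity), ← ENNReal.ofReal_mul (by positivity)]
    refine le_trans (ENNReal.ofReal_le_ofReal ?_) ENNReal.ofReal_add_le
    have hz := mul_mem_Icc_of_mem hδ (hF v)
    have hM : δ * fermiDirac δ R τ ε v = (1 + Real.exp (energy R τ ε v))⁻¹ := by
      rw [fermiDirac, mul_inv_cancel_left₀ hδ.ne']
    rw [hM]
    have hv0 : 0 ≤ vacancy δ F v := le_min hz.1 (one_sub_mem_Icc hz).1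
    have h1 := min_mul_abs_le_entropyFun_add (u := energy R τ ε v) hz
    have h2 : L / 2 * vacancy δ F v ≤ min (δ * F v) (1 - δ * F v) * (|energy R τ ε v| / 2) := by
      rw [mul_comm]
      exact mul_le_mul_of_nonneg_left (by linarith) hv0
    have h3 : ‖v‖ ^ 2 - R ^ 2 ≤ |energy R τ ε v| := by
      rcases le_total (‖v‖ ^ 2 - R ^ 2) 0 with h0 | h0
      · exact h0.trans (abs_nonneg _)
      · refine le_trans ?_ (le_abs_self _)
        rw [energy, le_div_iff₀ (Real.rpow_pos_of_pos hε τ)]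
        exact mul_le_of_le_one_right h0 (Real.rpow_le_one hε.le hε1 hτ)
    have h4 : Real.exp (-(|energy R τ ε v| / 2))
        ≤ Real.exp (-(L / 4)) * Real.exp ((R ^ 2 - ‖v‖ ^ 2) / 4) := by
      rw [← Real.exp_add]
      exact Real.exp_le_exp.2 (by linarith)
    linarith
  · simp

/-- The remainder does not decay in `x`; this is why the estimate is local in space. -/
theorem lintegral_outerVacancy_le {δ R τ ε L : ℝ} {F : E d → E d → ℝ} (hδ : 0 < δ)
    (hF : ∀ x v, F x v ∈ Icc 0 δ⁻¹) (hτ : 0 ≤ τ) (hε : 0 < ε) (hε1 : ε ≤ 1) (hL : 0 ≤ L)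
    (A : Set (E d)) :
    ENNReal.ofReal (L / 2) * ∫⁻ x in A, ∫⁻ v, outerVacancy δ R τ ε L (F x) v
      ≤ relEntropy δ F (fermiDirac δ R τ ε)
        + ENNReal.ofReal (Real.exp (-(L / 4))) * gaussianMass d R * volume A := by
  rw [← lintegral_const_mul' _ _ ENNReal.ofReal_ne_top]
  have h1 : ∀ x : E d, ENNReal.ofReal (L / 2) * ∫⁻ v, outerVacancy δ R τ ε L (F x) v
      ≤ (∫⁻ v, ENNReal.ofReal (entropyFun (δ * F x v) (δ * fermiDirac δ R τ ε v)))
        + ENNReal.ofReal (Real.exp (-(L / 4))) * gaussianMass d R := by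
    intro x
    rw [← lintegral_const_mul' _ _ ENNReal.ofReal_ne_top, gaussianMass,
      ← lintegral_const_mul' _ _ ENNReal.ofReal_ne_top, ← lintegral_add_right _ (by fun_prop)]
    exact lintegral_mono fun v => mul_outerVacancy_le hδ (hF x) hτ hε hε1 hL v
  refine (lintegral_mono h1).trans ?_
  rw [lintegral_add_right _ measurable_const, setLIntegral_const]
  exact add_le_add (setLIntegral_le_lintegral _ _) le_rfl

/-! ### The conservation defect -/

section Defect

variable {δ R τ κ α ε L : ℝ} {b : E d → S d → ℝ} {f : ℝ → E d → E d → ℝ}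

theorem measurable_collisionIntegrand_param (hb : IsCrossSection R b) (δ : ℝ)
    (hfm : Measurable fun p : ℝ × E d × E d => f p.1 p.2.1 p.2.2) :
    Measurable fun z : ((ℝ × E d) × E d) × (E d × S d) =>
      collisionIntegrand δ b (f z.1.1.1 z.1.1.2) z.1.2 z.2 := by
  have hc : Measurable fun z : ((ℝ × E d) × E d) × (E d × S d) => (z.1.2, z.2.1, z.2.2) := by
    fun_prop
  have hcomp : ∀ w : ((ℝ × E d) × E d) × (E d × S d) → E d, Measurable w →
      Measurable fun z => f z.1.1.1 z.1.1.2 (w z) := fun w hw =>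
    hfm.comp (f := fun z : ((ℝ × E d) × E d) × (E d × S d) => (z.1.1.1, z.1.1.2, w z))
      (by fun_prop)
  have h1 := hcomp _ (measurable_post.comp hc)
  have h2 := hcomp _ (measurable_postStar.comp hc)
  have h3 := hcomp (fun z => z.1.2) (by fun_prop)
  have h4 := hcomp (fun z => z.2.1) (by fun_prop)
  have one_sub : ∀ g : ((ℝ × E d) × E d) × (E d × S d) → ℝ, Measurable g →
      Measurable fun z => 1 - δ * g z := fun g hg => measurable_const.sub (hg.const_mul δ)
  exact ((((h1.mul h2).mul (one_sub _ h3)).mul (one_sub _ h4)).sub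
    (((h3.mul h4).mul (one_sub _ h1)).mul (one_sub _ h2))).mul
    ((measurable_crossSection hb).comp hc)

theorem measurable_truncEnergy_mul_collision (hb : IsCrossSection R b) (δ L : ℝ)
    (hfm : Measurable fun p : ℝ × E d × E d => f p.1 p.2.1 p.2.2) :
    Measurable fun q : (ℝ × E d) × E d =>
      truncEnergy R τ ε L q.2 * collision δ b (f q.1.1 q.1.2) q.2 :=
  ((measurable_truncEnergy R τ ε L).comp measurable_snd).mul
    (measurable_collisionIntegrand_param hb δ hfm).stronglyMeasurable.integral_prod_right'.measurable

theorem defect_eq (hε : 0 < ε) (p : ℝ × E d) :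
    defect δ R τ κ α ε b f p = (1 / ε ^ (κ + 1)) *
      ∫ v, truncEnergy R τ ε (-Real.log (ε ^ α)) v * collision δ b (f p.1 p.2) v := by
  simp only [defect, defectIntegrand_eq hε]

theorem measurable_defect (hb : IsCrossSection R b) (hε : 0 < ε)
    (hfm : Measurable fun p : ℝ × E d × E d => f p.1 p.2.1 p.2.2) :
    Measurable (defect δ R τ κ α ε b f) := by
  have h : defect δ R τ κ α ε b f = fun p => (1 / ε ^ (κ + 1)) *
      ∫ v, truncEnergy R τ ε (-Real.log (ε ^ α)) v * collision δ b (f p.1 p.2) v :=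
    funext fun p => defect_eq hε p
  rw [h]
  exact ((measurable_truncEnergy_mul_collision hb δ _
    hfm).stronglyMeasurable.integral_prod_right'.measurable).const_mul _

theorem norm_truncEnergy_mul_collision_le {F : E d → ℝ} (hb : IsCrossSection R b) (hδ : 0 < δ)
    (hF : ∀ v, F v ∈ Icc 0 δ⁻¹) (v : E d) :
    ‖truncEnergy R τ ε L v * collision δ b F v‖ ≤ |truncEnergy R τ ε L v| * ((δ ^ 2)⁻¹ *
      ∫ p : E d × S d, b p.1 p.2 ∂((volume : Measure (E d)).prod (surface d))) := by
  rw [Real.norm_eq_abs, abs_mul]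
  gcongr
  exact abs_collision_le hb hδ hF v

theorem integrable_defectIntegrand {F : E d → ℝ} (hb : IsCrossSection R b) (hδ : 0 < δ)
    (hε : 0 < ε) (hFm : Measurable F) (hF : ∀ v, F v ∈ Icc 0 δ⁻¹) :
    Integrable (defectIntegrand δ R τ α ε b F) := by
  rw [show defectIntegrand δ R τ α ε b F = _ from funext fun v => defectIntegrand_eq hε b F v]
  exact Integrable.mono' ((integrable_truncEnergy hε _).abs.mul_const _)
    ((measurable_truncEnergy R τ ε _).mul (measurable_collision hb δ hFm)).aestronglyMeasurable
    (Eventually.of_forall fun v => norm_truncEnergy_mul_collision_le hb hδ hF v)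

theorem integrableOn_defect (hb : IsCrossSection R b) (hδ : 0 < δ) (hε : 0 < ε)
    (hfm : Measurable fun p : ℝ × E d × E d => f p.1 p.2.1 p.2.2)
    (hf : ∀ t, 0 ≤ t → ∀ x v, f t x v ∈ Icc 0 δ⁻¹) {K : Set (ℝ × E d)} (hK : IsCompact K)
    (hK0 : K ⊆ Ici 0 ×ˢ univ) :
    IntegrableOn (defect δ R τ κ α ε b f) K := by
  refine Measure.integrableOn_of_bounded (M := (1 / ε ^ (κ + 1)) *
    ∫ v : E d, |truncEnergy R τ ε (-Real.log (ε ^ α)) v| * ((δ ^ 2)⁻¹ *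
      ∫ p : E d × S d, b p.1 p.2 ∂((volume : Measure (E d)).prod (surface d))))
    hK.measure_lt_top.ne (measurable_defect hb hε hfm).aestronglyMeasurable
    ((ae_restrict_mem hK.measurableSet).mono fun p hp => ?_)
  rw [defect_eq hε, norm_mul, Real.norm_of_nonneg (by positivity)]
  gcongr
  exact norm_integral_le_of_norm_le ((integrable_truncEnergy hε _).abs.mul_const _)
    (Eventually.of_forall fun v =>
      norm_truncEnergy_mul_collision_le hb hδ (hf p.1 (hK0 hp).1 p.2) v)

/-- This half of Tonelli's theorem needs no measurability, which spares the joint measurability in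
`(t, x)` of the integrated dissipation. -/
theorem setLIntegral_prod_le (A : Set ℝ) (B : Set (E d)) (g : ℝ × E d → ℝ≥0∞) :
    ∫⁻ p in A ×ˢ B, g p ≤ ∫⁻ t in A, ∫⁻ x in B, g (t, x) := by
  rw [Measure.volume_eq_prod, ← Measure.prod_restrict]
  exact lintegral_prod_le g

theorem lintegral_dissipationRate_le (hδ : 0 < δ) {g : ℝ → E d → E d → ℝ} (hb : IsCrossSection R b)
    (hgm : ∀ t x, Measurable (g t x)) (t : ℝ) (B : Set (E d)) :
    ∫⁻ x in B, ∫⁻ p, dissipationRate δ b (g t x) p ∂(collisionMeasure d)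
      ≤ ENNReal.ofReal (4 * δ) * entropyDissipation δ b (g t) := by
  have h : ENNReal.ofReal (4 * δ) * ENNReal.ofReal (1 / (4 * δ)) = 1 := by
    rw [← ENNReal.ofReal_mul (by positivity), mul_one_div_cancel (by positivity),
      ENNReal.ofReal_one]
  rw [entropyDissipation, ← mul_assoc, h, one_mul]
  refine (setLIntegral_le_lintegral _ _).trans (le_of_eq (lintegral_congr fun x => ?_))
  exact lintegral_collisionMeasure (measurable_dissipationRate δ hb (hgm t x))

theorem measurable_lintegral_outerVacancy
    (hfm : Measurable fun p : ℝ × E d × E d => f p.1 p.2.1 p.2.2) :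
    Measurable fun q : ℝ × E d => ∫⁻ v, outerVacancy δ R τ ε L (f q.1 q.2) v := by
  have hm : Measurable fun z : (ℝ × E d) × E d => f z.1.1 z.1.2 z.2 :=
    hfm.comp (f := fun z : (ℝ × E d) × E d => (z.1.1, z.1.2, z.2)) (by fun_prop)
  have h : Measurable fun z : (ℝ × E d) × E d => outerVacancy δ R τ ε L (f z.1.1 z.1.2) z.2 :=
    Measurable.ite
      (measurableSet_le measurable_const ((measurable_energy R τ ε).comp measurable_snd).abs)
      ((hm.const_mul δ).min (measurable_const.sub (hm.const_mul δ))).ennreal_ofReal measurable_const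
  exact h.lintegral_prod_right'

/-- Space-time bound of the truncated energy production by the vacancies outside the truncation and
the total entropy dissipation. -/
theorem lintegral_enorm_truncEnergy_mul_collision_le (hd : 2 ≤ d) (hb : IsCrossSection R b)
    (hδ : 0 < δ) (hε : 0 < ε) (hfm : Measurable fun p : ℝ × E d × E d => f p.1 p.2.1 p.2.2)
    (hf : ∀ t, 0 ≤ t → ∀ x v, f t x v ∈ Icc 0 δ⁻¹) (hL : 0 ≤ L) (hL1 : ε ^ τ * L ≤ 1)
    {θ : ℝ} (hθ : 0 < θ) {T : ℝ} {B : Set (E d)} (hB : MeasurableSet B) :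
    ∫⁻ p in Icc 0 T ×ˢ B, ‖∫ v, truncEnergy R τ ε L v * collision δ b (f p.1 p.2) v‖ₑ ≤
      ENNReal.ofReal (4 * L * (δ ^ 2)⁻¹) *
        (ENNReal.ofReal θ * (4 * (exitConstant R b * ENNReal.ofReal (ε ^ τ * L) *
            ∫⁻ t in Icc 0 T, ∫⁻ x in B, ∫⁻ v, outerVacancy δ R τ ε L (f t x) v))
          + ENNReal.ofReal (1 + θ⁻¹) * (ENNReal.ofReal (4 * δ) *
            ∫⁻ t in Icc 0 T, entropyDissipation δ b (f t))) := by
  have : Nonempty (Fin d) := ⟨⟨0, by omega⟩⟩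
  have : Nontrivial (E d) := inferInstance
  obtain ⟨e, he⟩ := exists_norm_eq (E d) zero_le_one
  let e' : S d := ⟨e, by simpa using he⟩
  have hgm : ∀ t x, Measurable (f t x) := fun t x =>
    hfm.comp (f := fun v : E d => (t, x, v)) (by fun_prop)
  have hpt : ∀ p ∈ Icc 0 T ×ˢ B,
      ‖∫ v, truncEnergy R τ ε L v * collision δ b (f p.1 p.2) v‖ₑ ≤
      ENNReal.ofReal (4 * L * (δ ^ 2)⁻¹) *
        (ENNReal.ofReal θ * (4 * (exitConstant R b * ENNReal.ofReal (ε ^ τ * L) *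
            ∫⁻ v, outerVacancy δ R τ ε L (f p.1 p.2) v))
          + ENNReal.ofReal (1 + θ⁻¹) *
            ∫⁻ q, dissipationRate δ b (f p.1 p.2) q ∂(collisionMeasure d)) := by
    intro p hp
    refine (enorm_integral_truncEnergy_mul_collision_le e' hb hδ hε (hgm _ _)
      (hf p.1 hp.1.1 p.2) hL hθ).trans ?_
    gcongr
    exact lintegral_exitRate_le hd hb (hgm _ _) hε hL hL1
  have hJ := measurable_lintegral_outerVacancy (δ := δ) (R := R) (τ := τ) (ε := ε) (L := L) hfm
  have hC : exitConstant R b * ENNReal.ofReal (ε ^ τ * L) ≠ ⊤ :=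
    ENNReal.mul_ne_top (exitConstant_ne_top hb) ENNReal.ofReal_ne_top
  refine (setLIntegral_mono' (measurableSet_Icc.prod hB) hpt).trans ?_
  rw [lintegral_const_mul' _ _ ENNReal.ofReal_ne_top, lintegral_add_left (by fun_prop),
    lintegral_const_mul' _ _ ENNReal.ofReal_ne_top, lintegral_const_mul' _ _ (by norm_num),
    lintegral_const_mul' _ _ hC, lintegral_const_mul' _ _ ENNReal.ofReal_ne_top,
    ← lintegral_const_mul' _ _ ENNReal.ofReal_ne_top (μ := volume.restrict (Icc 0 T))]
  gcongr
  · exact setLIntegral_prod_le _ _ _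
  · refine (setLIntegral_prod_le _ _ _).trans (lintegral_mono fun t => ?_)
    exact lintegral_dissipationRate_le hδ hb hgm t B

end Defect

/-! ### Consequences of the entropy inequality -/

section Entropy

variable {δ R τ κ ε : ℝ} {b : E d → S d → ℝ} {fin : E d → E d → ℝ} {f : ℝ → E d → E d → ℝ}

theorem IsEntropicSolution.lintegral_entropyDissipation_le
    (hsol : IsEntropicSolution δ R τ κ ε b fin f) (hε : 0 < ε) (T : ℝ) :
    ∫⁻ t in Icc 0 T, entropyDissipation δ b (f t)
      ≤ ENNReal.ofReal (ε ^ κ) * relEntropy δ fin (fermiDirac δ R τ ε) := by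
  have hκ := Real.rpow_pos_of_pos hε κ
  -- The entropy inequality may fail at `T` itself, but it holds at some later time, and the
  -- accumulated dissipation increases with time.
  obtain ⟨t, htT, ht⟩ : ∃ t, T < t ∧ relEntropy δ (f t) (fermiDirac δ R τ ε)
        + ENNReal.ofReal (1 / ε ^ κ) * ∫⁻ s in Ioc 0 t, entropyDissipation δ b (f s)
      ≤ relEntropy δ fin (fermiDirac δ R τ ε) := by
    have h1 : ∀ᵐ t ∂(volume.restrict (Ioi (max 0 T))), relEntropy δ (f t) (fermiDirac δ R τ ε)
        + ENNReal.ofReal (1 / ε ^ κ) * ∫⁻ s in Ioc 0 t, entropyDissipation δ b (f s)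
      ≤ relEntropy δ fin (fermiDirac δ R τ ε) :=
      ae_restrict_of_ae_restrict_of_subset (Ioi_subset_Ioi (le_max_left _ _)) hsol.entropy
    have hne : (ae (volume.restrict (Ioi (max 0 T)))).NeBot := by
      rw [ae_neBot, Ne, Measure.restrict_eq_zero]
      simp
    obtain ⟨t, ht, htT⟩ := (h1.and (ae_restrict_mem measurableSet_Ioi)).exists
    exact ⟨t, (le_max_right _ _).trans_lt htT, ht⟩
  have h1 : ENNReal.ofReal (ε ^ κ) * ENNReal.ofReal (1 / ε ^ κ) = 1 := by
    rw [← ENNReal.ofReal_mul hκ.le, mul_one_div_cancel hκ.ne', ENNReal.ofReal_one]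
  calc ∫⁻ s in Icc 0 T, entropyDissipation δ b (f s)
      = ∫⁻ s in Ioc 0 T, entropyDissipation δ b (f s) := setLIntegral_congr Ioc_ae_eq_Icc.symm
    _ ≤ ∫⁻ s in Ioc 0 t, entropyDissipation δ b (f s) :=
        lintegral_mono_set (Ioc_subset_Ioc_right htT.le)
    _ = ENNReal.ofReal (ε ^ κ) * (ENNReal.ofReal (1 / ε ^ κ)
          * ∫⁻ s in Ioc 0 t, entropyDissipation δ b (f s)) := by rw [← mul_assoc, h1, one_mul]
    _ ≤ _ := by
        gcongr
        exact le_add_self.trans ht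

theorem IsEntropicSolution.lintegral_outerVacancy_le
    (hsol : IsEntropicSolution δ R τ κ ε b fin f) (hδ : 0 < δ) (hτ : 0 ≤ τ) (hε : 0 < ε)
    (hε1 : ε ≤ 1) {L : ℝ} (hL : 0 ≤ L) (T : ℝ) (B : Set (E d)) :
    ENNReal.ofReal (L / 2) *
        ∫⁻ t in Icc 0 T, ∫⁻ x in B, ∫⁻ v, outerVacancy δ R τ ε L (f t x) v
      ≤ (relEntropy δ fin (fermiDirac δ R τ ε)
        + ENNReal.ofReal (Real.exp (-(L / 4))) * gaussianMass d R * volume B)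
        * ENNReal.ofReal T := by
  rw [← lintegral_const_mul' _ _ ENNReal.ofReal_ne_top, setLIntegral_congr Ioc_ae_eq_Icc.symm]
  have h : ∀ᵐ t ∂(volume.restrict (Ioc 0 T)),
      ENNReal.ofReal (L / 2) * ∫⁻ x in B, ∫⁻ v, outerVacancy δ R τ ε L (f t x) v
        ≤ relEntropy δ fin (fermiDirac δ R τ ε)
          + ENNReal.ofReal (Real.exp (-(L / 4))) * gaussianMass d R * volume B := by
    filter_upwards [ae_restrict_of_ae_restrict_of_subset Ioc_subset_Ioi_self hsol.entropy,
      ae_restrict_mem measurableSet_Ioc] with t ht ht0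
    refine (FermiGas.lintegral_outerVacancy_le hδ (hsol.mem t ht0.1.le) hτ hε hε1 hL B).trans ?_
    gcongr
    exact le_self_add.trans ht
  refine (lintegral_mono_ae h).trans (le_of_eq ?_)
  rw [setLIntegral_const, Real.volume_Ioc, sub_zero]

/-- Quantitative decay of the conservation defects on bounded sets. -/
theorem IsEntropicSolution.lintegral_enorm_defect_le (hd : 2 ≤ d)
    (hsol : IsEntropicSolution δ R τ κ ε b fin f) (hb : IsCrossSection R b) (hδ : 0 < δ)
    (hτ : 0 ≤ τ) (hτκ : τ ≤ κ) (hε : 0 < ε) (hε1 : ε ≤ 1) {α : ℝ} (hα : 8 ≤ α)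
    (hL1 : ε ^ τ * -Real.log (ε ^ α) ≤ 1) {Cin : ℝ} (hCin : 0 ≤ Cin)
    (hH : ENNReal.ofReal (1 / ε ^ (2 - τ)) * relEntropy δ fin (fermiDirac δ R τ ε)
      ≤ ENNReal.ofReal Cin) {T : ℝ} {B : Set (E d)} (hB : MeasurableSet B) :
    ∫⁻ p in Icc 0 T ×ˢ B, ‖defect δ R τ κ α ε b f p‖ₑ
      ≤ (ENNReal.ofReal (4 * (δ ^ 2)⁻¹) * (8 * exitConstant R b
          * ((ENNReal.ofReal Cin + gaussianMass d R * volume B) * ENNReal.ofReal T)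
          + ENNReal.ofReal (8 * δ * Cin)))
        * ENNReal.ofReal (-Real.log (ε ^ α) * ε ^ (1 - (κ + τ) / 2)) := by
  set L := -Real.log (ε ^ α) with hLdef
  have hL : 0 ≤ L := by
    rw [hLdef, neg_nonneg]
    exact Real.log_nonpos (by positivity) (Real.rpow_le_one hε.le hε1 (by linarith))
  -- This exponent equates `θ ε^2` with `θ⁻¹ ε^(κ+2-τ)`. Since `τ ≤ κ`, it gives `θ ≤ 1`, whence `1
  -- + θ⁻¹ ≤ 2θ⁻¹`.
  set ν := (κ - τ) / 2 with hν
  have hν0 : 0 ≤ ν := by rw [hν]; linarith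
  set θ := ε ^ ν with hθdef
  have hθ : 0 < θ := Real.rpow_pos_of_pos hε ν
  have hθ1 : θ ≤ 1 := Real.rpow_le_one hε.le hε1 hν0
  have he := Real.rpow_pos_of_pos hε (2 - τ)
  have hH' : relEntropy δ fin (fermiDirac δ R τ ε)
      ≤ ENNReal.ofReal (ε ^ (2 - τ)) * ENNReal.ofReal Cin := by
    have h1 : ENNReal.ofReal (ε ^ (2 - τ)) * ENNReal.ofReal (1 / ε ^ (2 - τ)) = 1 := by
      rw [← ENNReal.ofReal_mul he.le, mul_one_div_cancel he.ne', ENNReal.ofReal_one]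
    calc _ = ENNReal.ofReal (ε ^ (2 - τ)) * (ENNReal.ofReal (1 / ε ^ (2 - τ))
          * relEntropy δ fin (fermiDirac δ R τ ε)) := by rw [← mul_assoc, h1, one_mul]
      _ ≤ _ := by gcongr
  -- Here `e^(-L/4) = ε^(α/4)`, and `α ≥ 8` makes the tail no larger than the entropy.
  have hexp : Real.exp (-(L / 4)) ≤ ε ^ (2 - τ) := by
    have : Real.exp (-(L / 4)) = ε ^ (α / 4) := by
      rw [hLdef, Real.log_rpow hε, Real.rpow_def_of_pos hε]
      congr 1; ring
    rw [this]
    exact Real.rpow_le_rpow_of_exponent_ge hε hε1 (by linarith)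
  have hJ := hsol.lintegral_outerVacancy_le hδ hτ hε hε1 hL T B
  have hJ' : ENNReal.ofReal (L / 2) *
        ∫⁻ t in Icc 0 T, ∫⁻ x in B, ∫⁻ v, outerVacancy δ R τ ε L (f t x) v
      ≤ ENNReal.ofReal (ε ^ (2 - τ)) *
        ((ENNReal.ofReal Cin + gaussianMass d R * volume B) * ENNReal.ofReal T) := by
    refine hJ.trans ?_
    calc _ ≤ (ENNReal.ofReal (ε ^ (2 - τ)) * ENNReal.ofReal Cin
          + ENNReal.ofReal (ε ^ (2 - τ)) * gaussianMass d R * volume B) * ENNReal.ofReal T := by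
          gcongr
      _ = _ := by ring
  have hD' : ∫⁻ t in Icc 0 T, entropyDissipation δ b (f t)
      ≤ ENNReal.ofReal (ε ^ κ) * (ENNReal.ofReal (ε ^ (2 - τ)) * ENNReal.ofReal Cin) :=
    (hsol.lintegral_entropyDissipation_le hε T).trans (by gcongr)
  have hmain := lintegral_enorm_truncEnergy_mul_collision_le (τ := τ) (T := T) hd hb hδ hε
    hsol.measurable hsol.mem hL hL1 hθ hB
  set J := ∫⁻ t in Icc 0 T, ∫⁻ x in B, ∫⁻ v, outerVacancy δ R τ ε L (f t x) v with hJdef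
  set W := (ENNReal.ofReal Cin + gaussianMass d R * volume B) * ENNReal.ofReal T with hW
  have hκ1 : 0 < 1 / ε ^ (κ + 1) := by positivity
  have hετ := Real.rpow_pos_of_pos hε τ
  -- The `L` in the volume of the shells is absorbed by the `L/2` gained in the entropy bound of
  -- `J`.
  have hfirst : 4 * (exitConstant R b * ENNReal.ofReal (ε ^ τ * L) * J)
      ≤ 8 * exitConstant R b * W * ENNReal.ofReal (ε ^ τ * ε ^ (2 - τ)) := by
    have h2 : ENNReal.ofReal (ε ^ τ * L)
        = ENNReal.ofReal (ε ^ τ) * (2 * ENNReal.ofReal (L / 2)) := by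
      rw [ENNReal.ofReal_mul hετ.le, show L / 2 = 2⁻¹ * L by ring,
        ENNReal.ofReal_mul (p := 2⁻¹) (by norm_num), ENNReal.ofReal_inv_of_pos two_pos,
        ENNReal.ofReal_ofNat, ← mul_assoc 2,
        ENNReal.mul_inv_cancel two_ne_zero ENNReal.ofNat_ne_top, one_mul]
    calc 4 * (exitConstant R b * ENNReal.ofReal (ε ^ τ * L) * J)
        = 8 * exitConstant R b * ENNReal.ofReal (ε ^ τ) * (ENNReal.ofReal (L / 2) * J) := by
          rw [h2]; ring
      _ ≤ 8 * exitConstant R b * ENNReal.ofReal (ε ^ τ) * (ENNReal.ofReal (ε ^ (2 - τ)) * W) := by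
          gcongr
      _ = _ := by rw [ENNReal.ofReal_mul hετ.le]; ring
  have hsecond : ENNReal.ofReal (1 + θ⁻¹) * (ENNReal.ofReal (4 * δ) *
        ∫⁻ t in Icc 0 T, entropyDissipation δ b (f t))
      ≤ ENNReal.ofReal (8 * δ * Cin) * ENNReal.ofReal (θ⁻¹ * (ε ^ κ * ε ^ (2 - τ))) := by
    have h1 : 1 + θ⁻¹ ≤ 2 * θ⁻¹ := by linarith [(one_le_inv₀ hθ).2 hθ1]
    calc _ ≤ ENNReal.ofReal (2 * θ⁻¹) * (ENNReal.ofReal (4 * δ) *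
          (ENNReal.ofReal (ε ^ κ) * (ENNReal.ofReal (ε ^ (2 - τ)) * ENNReal.ofReal Cin))) := by
          gcongr
      _ = _ := by
          rw [← ENNReal.ofReal_mul he.le, ← ENNReal.ofReal_mul (by positivity),
            ← ENNReal.ofReal_mul (by positivity), ← ENNReal.ofReal_mul (by positivity),
            ← ENNReal.ofReal_mul (by positivity)]
          congr 1; ring
  have p1 : (1 / ε ^ (κ + 1)) * L * (θ * (ε ^ τ * ε ^ (2 - τ))) = L * ε ^ (1 - (κ + τ) / 2) := by
    have : ε ^ (1 - (κ + τ) / 2) = ε ^ (-(κ + 1)) * ε ^ ν * ε ^ τ * ε ^ (2 - τ) := by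
      rw [← Real.rpow_add hε, ← Real.rpow_add hε, ← Real.rpow_add hε]
      congr 1; rw [hν]; ring
    rw [this, Real.rpow_neg hε.le]; ring
  have p2 : (1 / ε ^ (κ + 1)) * L * (θ⁻¹ * (ε ^ κ * ε ^ (2 - τ))) = L * ε ^ (1 - (κ + τ) / 2) := by
    have : ε ^ (1 - (κ + τ) / 2) = ε ^ (-(κ + 1)) * ε ^ (-ν) * ε ^ κ * ε ^ (2 - τ) := by
      rw [← Real.rpow_add hε, ← Real.rpow_add hε, ← Real.rpow_add hε]
      congr 1; rw [hν]; ring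
    rw [this, Real.rpow_neg hε.le, Real.rpow_neg hε.le]; ring
  have hL4 : ENNReal.ofReal (4 * L * (δ ^ 2)⁻¹)
      = ENNReal.ofReal (4 * (δ ^ 2)⁻¹) * ENNReal.ofReal L := by
    rw [← ENNReal.ofReal_mul (by positivity)]; congr 1; ring
  calc ∫⁻ p in Icc 0 T ×ˢ B, ‖defect δ R τ κ α ε b f p‖ₑ
      = ENNReal.ofReal (1 / ε ^ (κ + 1)) * ∫⁻ p in Icc 0 T ×ˢ B,
          ‖∫ v, truncEnergy R τ ε L v * collision δ b (f p.1 p.2) v‖ₑ := by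
        rw [← lintegral_const_mul' _ _ ENNReal.ofReal_ne_top]
        refine lintegral_congr fun p => ?_
        rw [defect_eq hε, enorm_mul, Real.enorm_of_nonneg hκ1.le]
    _ ≤ ENNReal.ofReal (1 / ε ^ (κ + 1)) * (ENNReal.ofReal (4 * L * (δ ^ 2)⁻¹) *
          (ENNReal.ofReal θ * (8 * exitConstant R b * W * ENNReal.ofReal (ε ^ τ * ε ^ (2 - τ)))
          + ENNReal.ofReal (8 * δ * Cin) * ENNReal.ofReal (θ⁻¹ * (ε ^ κ * ε ^ (2 - τ))))) := by
        refine mul_le_mul' le_rfl (hmain.trans ?_)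
        gcongr
    _ = ENNReal.ofReal (4 * (δ ^ 2)⁻¹) * (8 * exitConstant R b * W * (ENNReal.ofReal
          (1 / ε ^ (κ + 1)) * ENNReal.ofReal L * (ENNReal.ofReal θ
            * ENNReal.ofReal (ε ^ τ * ε ^ (2 - τ))))
          + ENNReal.ofReal (8 * δ * Cin) * (ENNReal.ofReal (1 / ε ^ (κ + 1)) * ENNReal.ofReal L *
            ENNReal.ofReal (θ⁻¹ * (ε ^ κ * ε ^ (2 - τ))))) := by
        rw [hL4]; ring
    _ = _ := by
        rw [← ENNReal.ofReal_mul hθ.le, ← ENNReal.ofReal_mul hκ1.le,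
          ← ENNReal.ofReal_mul (by positivity), ← ENNReal.ofReal_mul (by positivity), p1, p2]
        ring

end Entropy

/-! ### Passage to the limit -/

theorem tendsto_log_rpow_mul_rpow {s : ℝ} (hs : 0 < s) (α : ℝ) :
    Tendsto (fun ε : ℝ => -Real.log (ε ^ α) * ε ^ s) (𝓝[>] 0) (𝓝 0) := by
  have h := (tendsto_log_mul_rpow_nhdsGT_zero hs).const_mul (-α)
  rw [mul_zero] at h
  refine h.congr' ?_
  filter_upwards [self_mem_nhdsWithin] with ε hε
  rw [Real.log_rpow hε]; ring

end FermiGas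

end

theorem mainTheorem10 (d : ℕ) (hd : 3 ≤ d) (δ R τ κ : ℝ) (hδ : 0 < δ) (hR : 0 < R)
    (hτ : 0 < τ) (hτ' : τ < 2 / 3) (hκ : 2 * τ < κ) (hκ' : κ < 2 - τ) :
    ∃ α₀ : ℝ, 0 < α₀ ∧ ∀ α : ℝ, α₀ ≤ α →
      ∀ b : FermiGas.E d → FermiGas.S d → ℝ, FermiGas.IsCrossSection R b →
      ∀ Cin : ℝ, 0 < Cin →
      ∀ Λ : Set ℝ, Λ ⊆ Ioi 0 →
      ∀ (fin : ℝ → FermiGas.E d → FermiGas.E d → ℝ)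
        (f : ℝ → ℝ → FermiGas.E d → FermiGas.E d → ℝ),
      (∀ ε ∈ Λ, FermiGas.IsEntropicSolution δ R τ κ ε b (fin ε) (f ε)) →
      (∀ ε ∈ Λ, ENNReal.ofReal (1 / ε ^ (2 - τ)) *
        FermiGas.relEntropy δ (fin ε) (FermiGas.fermiDirac δ R τ ε) ≤ ENNReal.ofReal Cin) →
      (∀ ε ∈ Λ, ∀ t : ℝ, 0 ≤ t → ∀ x : FermiGas.E d,
        (∀ v : FermiGas.E d, Integrable (FermiGas.collisionIntegrand δ b (f ε t x) v)
          ((volume : Measure (FermiGas.E d)).prod (FermiGas.surface d))) ∧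
        Integrable (FermiGas.defectIntegrand δ R τ α ε b (f ε t x))) ∧
      ∀ K : Set (ℝ × FermiGas.E d), IsCompact K → K ⊆ Ici 0 ×ˢ univ →
        (∀ ε ∈ Λ, IntegrableOn (FermiGas.defect δ R τ κ α ε b (f ε)) K) ∧
        Tendsto (fun ε => ∫⁻ p in K, ‖FermiGas.defect δ R τ κ α ε b (f ε) p‖ₑ)
          (𝓝[Λ] 0) (𝓝 0) := by
  refine ⟨8, by norm_num, fun α hα b hb Cin hCin Λ hΛ fin f hsol hH => ⟨?_, ?_⟩⟩
  · intro ε hε t ht x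
    have hm : Measurable (f ε t x) := (hsol ε hε).measurable.comp
      (f := fun v : FermiGas.E d => (t, x, v)) (by fun_prop)
    have hF := (hsol ε hε).mem t ht x
    exact ⟨FermiGas.integrable_collisionIntegrand hb hδ hm hF,
      FermiGas.integrable_defectIntegrand hb hδ (hΛ hε) hm hF⟩
  · intro K hK hK0
    refine ⟨fun ε hε => FermiGas.integrableOn_defect hb hδ (hΛ hε) (hsol ε hε).measurable
      (hsol ε hε).mem hK hK0, ?_⟩
    obtain ⟨r, hr⟩ := hK.isBounded.subset_closedBall 0
    have hKsub : K ⊆ Icc 0 r ×ˢ Metric.closedBall (0 : FermiGas.E d) r := by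
      intro p hp
      have h1 := hr hp
      rw [mem_closedBall_zero_iff, Prod.norm_def, max_le_iff] at h1
      exact ⟨⟨(hK0 hp).1, (le_abs_self _).trans h1.1⟩, by simpa using h1.2⟩
    set C := ENNReal.ofReal (4 * (δ ^ 2)⁻¹) * (8 * FermiGas.exitConstant R b
      * ((ENNReal.ofReal Cin
        + FermiGas.gaussianMass d R * volume (Metric.closedBall (0 : FermiGas.E d) r))
          * ENNReal.ofReal r)
      + ENNReal.ofReal (8 * δ * Cin)) with hC
    have hCtop : C ≠ ⊤ := by
      have h1 := FermiGas.exitConstant_ne_top hb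
      have h2 := FermiGas.gaussianMass_ne_top d R
      have h3 : volume (Metric.closedBall (0 : FermiGas.E d) r) ≠ ⊤ :=
        measure_closedBall_lt_top.ne
      rw [hC]
      finiteness
    -- The condition `κ + τ < 2` gives the power of `ε` that beats the logarithm.
    have hs : 0 < 1 - (κ + τ) / 2 := by linarith
    have hmono : 𝓝[Λ] (0 : ℝ) ≤ 𝓝[>] 0 := nhdsWithin_mono _ hΛ
    have hlim : Tendsto (fun ε : ℝ => C * ENNReal.ofReal
        (-Real.log (ε ^ α) * ε ^ (1 - (κ + τ) / 2))) (𝓝[Λ] 0) (𝓝 0) := by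
      have h := ENNReal.Tendsto.const_mul (a := C) (ENNReal.tendsto_ofReal
        ((FermiGas.tendsto_log_rpow_mul_rpow hs α).mono_left hmono)) (Or.inr hCtop)
      simpa using h
    -- For small `ε` the shells stay in a fixed ball, as the volume bound requires.
    have hsmall : ∀ᶠ ε in 𝓝[Λ] (0 : ℝ), -Real.log (ε ^ α) * ε ^ τ < 1 :=
      ((FermiGas.tendsto_log_rpow_mul_rpow hτ α).mono_left hmono).eventually_lt_const one_pos
    have hone : ∀ᶠ ε in 𝓝[Λ] (0 : ℝ), ε < 1 :=
      (tendsto_id.mono_left nhdsWithin_le_nhds).eventually_lt_const one_pos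
    refine tendsto_of_tendsto_of_tendsto_of_le_of_le' tendsto_const_nhds hlim
      (Eventually.of_forall fun _ => zero_le) ?_
    filter_upwards [hsmall, hone, self_mem_nhdsWithin] with ε h1 h2 hε
    exact (lintegral_mono_set hKsub).trans ((hsol ε hε).lintegral_enorm_defect_le (by omega) hb hδ
      hτ.le (by linarith) (hΛ hε) h2.le hα (by rw [mul_comm]; exact h1.le) hCin.le (hH ε hε)
      Metric.isClosed_closedBall.measurableSet)
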